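/- **Setting.** Let $(V,Y,\mathbf 1,\omega)$ be a vertex operator algebra over $\mathbb C$ with grading $V=\coprod_{n\in\mathbb Z}V_{(n)}$ (with $\dim V_{(n)}<\infty$ and $V_{(n)}=0$ for $n$ sufficiently negative; weights may be negative), let $W$ be a weak $V$-module (all axioms of a $V$-module except that no grading is required), $U$ a complex vector space, and $z$ a nonzero complex number. Write $Y(v,x)=\sum_{n}v_nx^{-n-1}$, $Y(\omega,x)=\sum_n L(n)x^{-n-2}$, and $\mathrm{wt}\,v=n$ for $v\in V_{(n)}$. For $n\in\mathbb Z$ and $c\in\mathbb C^\times$, $(x+c)^n=\sum_{i\ge0}\binom ni c^ix^{n-i}$ and $(c+x)^n=\sum_{i\ge0}\binom ni c^{n-i}x^i$. Put $$Y^o(v,x)=Y\bigl(e^{xL(1)}(-x^{-2})^{L(0)}v,\,x^{-1}\bigr);$$ for $w\in W$, $Y^o(v,x)w\in W((x^{-1}))$, and $Y^o(v,x+z)w$ is obtained by substituting $x+z$ for $x$ and expanding in nonnegative powers of $z$. * Let $\mathcal D_{P(z)}(W,U)$ be the space of $f\in\mathrm{Hom}(W,U)$ such that for every $v\in V$ there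 are $k,l\in\mathbb N$ with $(x-z)^kx^l\langle u^*,fY^o(v,x)w\rangle\in\mathbb C[x]$ for all $u^*\in U^*$, $w\in W$. For $f\in\mathcal D_{P(z)}(W,U)$, $v\in V$, define $Y^L(v,x)f,\ Y^R(v,x)f\in(\mathrm{Hom}(W,U))[[x,x^{-1}]]$ by $$(Y^L(v,x)f)(w)=(z+x)^{-l}\bigl((x+z)^lfY^o(v,x+z)w\bigr),\qquad (Y^R(v,x)f)(w)=(-z+x)^{-k}\bigl((x-z)^kfY^o(v,x)w\bigr),$$ where $k,l$ are any integers with $(x-z)^kx^lfY^o(v,x)w\in U[x]$ for all $w\in W$ (the result does not depend on the choice). With $Y(u\otimes v,x)=Y^L(u,x)Y^R(v,x)$, $\mathcal D_{P(z)}(W,U)$ is a weak $V\otimes V$-module. * Let $\Omega(\mathcal D_{P(z)}(W,U))$ be the set of $f\in\mathcal D_{P(z)}(W,U)$ such that $a_nf=0$ for every homogeneous $a\in V\otimes V$ and every $n\ge\mathrm{wt}\,a$. * Let $O(W,z)\subset W$ be the linear span of the elements $\mathrm{Res}_x\,x^{-2}(1-zx)^{\mathrm{wt}\,v}Y(v,x)w$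 for homogeneous $v\in V$ and $w\in W$ (with $(1-zx)^n$ expanded in nonnegative powers of $x$), and let $A(W,z)=W/O(W,z)$. Regard $\mathrm{Hom}(A(W,z),U)$ as a subspace of $\mathrm{Hom}(W,U)$ through the projection $W\to A(W,z)$. **Proposition.** As subspaces of $\mathrm{Hom}(W,U)$, $$\mathrm{Hom}(A(W,z),U)=\Omega(\mathcal D_{P(z)}(W,U))=\bigl\{f\in\mathrm{Hom}(W,U)\ \big|\ x^{\mathrm{wt}\,v}(x-z)^{\mathrm{wt}\,v}fY^o(v,x)\in(\mathrm{Hom}(W,U))[[x]]\ \text{for all homogeneous }v\in V\bigr\}.$$ Furthermore, for every $f\in\mathrm{Hom}(A(W,z),U)$ and every homogeneous $v\in V$, $$(-z+x)^{\mathrm{wt}\,v}\,Y^R(v,x)f=(x-z)^{\mathrm{wt}\,v}fY^o(v,x),\qquad (z+x)^{\mathrm{wt}\,v}\,Y^L(v,x)f=(x+z)^{\mathrm{wt}\,v}fY^o(v,x+z).$$ -/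

import Mathlib

noncomputable section

namespace VOA

/-- The Borcherds (component) form of the Jacobi identity, for modes `a u n` of `u` on `W`
and modes `b u n` of `u` on `V` (where `u` has the vertex operator `∑ n, u_n x ^ (-n-1)`):
`∑_{i ≥ 0} (-1)^i (l choose i) (u_{m+l-i} v_{n+i} w - (-1)^l v_{n+l-i} u_{m+i} w)
  = ∑_{i ≥ 0} (m choose i) (u_{l+i} v)_{m+n-i} w`.
The sums are finite when the modes are lower truncated. -/
def JacobiIdentity {V W : Type*} [AddCommGroup V] [Module ℂ V] [AddCommGroup W] [Module ℂ W]
    (b : V → ℤ → Module.End ℂ V) (a : V → ℤ → Module.End ℂ W) : Prop :=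
  ∀ (u v : V) (w : W) (l m n : ℤ),
    (∑ᶠ i : ℕ, (((-1 : ℂ) ^ i * (Ring.choose l i : ℤ)) •
        (a u (m + l - i) (a v (n + i) w) - (-1 : ℂ) ^ l • a v (n + l - i) (a u (m + i) w)))) =
      ∑ᶠ i : ℕ, ((Ring.choose m i : ℤ) : ℂ) • a (b u (l + i) v) (m + n - i) w

/-- The Virasoro relations of central charge `c` for a family of operators `L n`. -/
def VirasoroRelations {W : Type*} [AddCommGroup W] [Module ℂ W]
    (L : ℤ → Module.End ℂ W) (c : ℂ) : Prop :=
  ∀ m n : ℤ, L m * L n - L n * L m =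
    ((m : ℂ) - n) • L (m + n) +
      (if m + n = 0 then (((m : ℂ) ^ 3 - m) / 12 * c) • (1 : Module.End ℂ W) else 0)

/-- A vertex operator algebra `(V, Y, 𝟏, ω)` over `ℂ`. The map `Y` takes values in
`VertexOperator ℂ V`, i.e. `Y(v, x) w` is a Laurent series in `x`, and
`VertexOperator.ncoeff (Y v) n` is the mode `v_n`, the coefficient of `x ^ (-n-1)`. -/
class VertexOperatorAlgebra (V : Type*) [AddCommGroup V] [Module ℂ V] where
  /-- the state-field correspondence -/
  Y : V →ₗ[ℂ] VertexOperator ℂ V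
  /-- the vacuum vector -/
  vacuum : V
  /-- the Virasoro element -/
  conformal : V
  /-- the rank -/
  centralCharge : ℂ
  /-- the homogeneous subspaces `V_(n)` -/
  grade : ℤ → Submodule ℂ V
  /-- `V` is the direct sum of its homogeneous subspaces -/
  decomposition : DirectSum.Decomposition grade
  finiteDimensional_grade : ∀ n, FiniteDimensional ℂ (grade n)
  grade_eq_bot : ∃ N : ℤ, ∀ n < N, grade n = ⊥
  vacuum_mem : vacuum ∈ grade 0
  conformal_mem : conformal ∈ grade 2
  vacuum_mode : ∀ n : ℤ, VertexOperator.ncoeff (Y vacuum) n = if n = -1 then 1 else 0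
  mode_vacuum : ∀ (v : V) (n : ℤ), 0 ≤ n → VertexOperator.ncoeff (Y v) n vacuum = 0
  mode_neg_one_vacuum : ∀ v : V, VertexOperator.ncoeff (Y v) (-1) vacuum = v
  jacobi : JacobiIdentity (fun v n => VertexOperator.ncoeff (Y v) n)
    (fun v n => VertexOperator.ncoeff (Y v) n)
  virasoro : VirasoroRelations (fun n => VertexOperator.ncoeff (Y conformal) (n + 1)) centralCharge
  L_zero : ∀ (n : ℤ), ∀ v ∈ grade n, VertexOperator.ncoeff (Y conformal) 1 v = (n : ℂ) • v
  L_neg_one : ∀ (v : V) (n : ℤ),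
    VertexOperator.ncoeff (Y (VertexOperator.ncoeff (Y conformal) 0 v)) n =
      (-n : ℂ) • VertexOperator.ncoeff (Y v) (n - 1)

attribute [reducible, instance] VertexOperatorAlgebra.decomposition

/-- A weak `V`-module: all the axioms of a module for the vertex operator algebra `V`, except that
no grading is required. -/
class WeakModule (V W : Type*) [AddCommGroup V] [Module ℂ V] [VertexOperatorAlgebra V]
    [AddCommGroup W] [Module ℂ W] where
  /-- the action; `Y(v, x) w` is a Laurent series -/
  Y : V →ₗ[ℂ] VertexOperator ℂ W
  vacuum_mode : ∀ n : ℤ,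
    VertexOperator.ncoeff (Y (VertexOperatorAlgebra.vacuum : V)) n = if n = -1 then 1 else 0
  jacobi : JacobiIdentity (fun v n => VertexOperator.ncoeff (VertexOperatorAlgebra.Y (V := V) v) n)
    (fun v n => VertexOperator.ncoeff (Y v) n)
  virasoro : VirasoroRelations
    (fun n => VertexOperator.ncoeff (Y (VertexOperatorAlgebra.conformal : V)) (n + 1))
    (VertexOperatorAlgebra.centralCharge V)
  L_neg_one : ∀ (v : V) (n : ℤ),
    VertexOperator.ncoeff
        (Y (VertexOperator.ncoeff
          (VertexOperatorAlgebra.Y (VertexOperatorAlgebra.conformal : V)) 0 v)) n =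
      (-n : ℂ) • VertexOperator.ncoeff (Y v) (n - 1)

section Series

/-! Formal series `A(x) = ∑ A_p x^p` in `Hom(W,U)[[x, x⁻¹]]` are functions `ℤ → (W →ₗ[ℂ] U)`,
indexed by the exponent `p`. -/

variable {W U : Type*} [AddCommGroup W] [Module ℂ W] [AddCommGroup U] [Module ℂ U]

open Classical in
/-- The sum of a family of linear maps which is finite on every vector
(and `0` if the family is not summable in this sense). -/
def locSum {ι : Type*} (g : ι → W →ₗ[ℂ] U) : W →ₗ[ℂ] U :=
  if h : ∀ w, (Function.support fun i => g i w).Finite then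
    { toFun := fun w => ∑ᶠ i, g i w
      map_add' := fun w w' => by
        simp only [map_add]
        exact finsum_add_distrib (h w) (h w')
      map_smul' := fun c w => by
        simp only [map_smul, RingHom.id_apply]
        exact (smul_finsum' c (h w)).symm }
  else 0

/-- `x^l A(x)`. -/
def mulX (l : ℤ) (A : ℤ → W →ₗ[ℂ] U) : ℤ → W →ₗ[ℂ] U := fun p => A (p - l)

/-- `(x + c)^k A(x)`, where `(x + c)^k = ∑_{i ≥ 0} (k choose i) c^i x^(k-i)`. -/
def mulXAddPow (c : ℂ) (k : ℤ) (A : ℤ → W →ₗ[ℂ] U) : ℤ → W →ₗ[ℂ] U := fun p =>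
  locSum fun i : ℕ => ((Ring.choose k i : ℤ) * c ^ i : ℂ) • A (p - k + i)

/-- `(c + x)^k A(x)`, where `(c + x)^k = ∑_{i ≥ 0} (k choose i) c^(k-i) x^i`. -/
def mulAddXPow (c : ℂ) (k : ℤ) (A : ℤ → W →ₗ[ℂ] U) : ℤ → W →ₗ[ℂ] U := fun p =>
  locSum fun i : ℕ => ((Ring.choose k i : ℤ) * c ^ (k - i) : ℂ) • A (p - i)

/-- `A(x + c)`, where every power `(x + c)^n` is expanded in nonnegative powers of `c`. -/
def shift (c : ℂ) (A : ℤ → W →ₗ[ℂ] U) : ℤ → W →ₗ[ℂ] U := fun p =>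
  locSum fun i : ℕ => ((Ring.choose (p + i) i : ℤ) * c ^ i : ℂ) • A (p + i)

/-- The series `∑ a_p x^p` lies in `E[x]`. -/
def IsPolynomial {E : Type*} [Zero E] (a : ℤ → E) : Prop :=
  (∀ p < 0, a p = 0) ∧ (Function.support a).Finite

end Series

section Module

variable (V : Type*) {W U : Type*} [AddCommGroup V] [Module ℂ V] [VertexOperatorAlgebra V]
  [AddCommGroup W] [Module ℂ W] [WeakModule V W] [AddCommGroup U] [Module ℂ U]

variable {V} in
/-- The mode `v_n` acting on the weak module `W`. -/
def mode (W : Type*) [AddCommGroup W] [Module ℂ W] [WeakModule V W] (v : V) (n : ℤ) :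
    Module.End ℂ W :=
  VertexOperator.ncoeff (WeakModule.Y v) n

/-- The homogeneous subspace `V_(n)`. -/
abbrev homog (n : ℤ) : Submodule ℂ V := VertexOperatorAlgebra.grade n

/-- The operator `L(1) = ω_2` on `V`. -/
def L1 : Module.End ℂ V :=
  VertexOperator.ncoeff (VertexOperatorAlgebra.Y (VertexOperatorAlgebra.conformal : V)) 2

variable {V}

/-- The homogeneous component of weight `n` of `v`. -/
def component (v : V) (n : ℤ) : V :=
  (DirectSum.decompose (VertexOperatorAlgebra.grade (V := V)) v n : V)

/-- The coefficient of `x^p` in `Y^o(v, x) = Y(e^{x L(1)} (-x^{-2})^{L(0)} v, x⁻¹)` on `W`.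
If `v` has weight `n` then `e^{x L(1)} (-x^{-2})^{L(0)} v = ∑_i (-1)^n x^(i-2n) L(1)^i v / i!`, and
`Y(u, x⁻¹) = ∑_m u_m x^(m+1)`. Both sums below have only finitely many nonzero terms. -/
def opp (W : Type*) [AddCommGroup W] [Module ℂ W] [WeakModule V W] (v : V) (p : ℤ) :
    Module.End ℂ W :=
  ∑ᶠ n : ℤ, ∑ᶠ i : ℕ, ((-1 : ℂ) ^ n / (i.factorial : ℂ)) •
    mode W (((L1 V) ^ i) (component v n)) (p - 1 - i + 2 * n)

/-- The series `f Y^o(v, x)` in `Hom(W,U)[[x, x⁻¹]]`. -/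
def compOpp (f : W →ₗ[ℂ] U) (v : V) : ℤ → W →ₗ[ℂ] U := fun p => f ∘ₗ opp W v p

variable (V) in
/-- The space `D_{P(z)}(W,U)`: those `f` such that for every `v` there are `k, l ∈ ℕ` with
`(x - z)^k x^l ⟨u*, f Y^o(v,x) w⟩ ∈ ℂ[x]` for all `u* ∈ U*` and `w ∈ W`. -/
def regular (W U : Type*) [AddCommGroup W] [Module ℂ W] [WeakModule V W]
    [AddCommGroup U] [Module ℂ U] (z : ℂ) : Set (W →ₗ[ℂ] U) :=
  {f | ∀ v : V, ∃ k l : ℕ, ∀ (u' : Module.Dual ℂ U) (w : W),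
    IsPolynomial fun p => mulXAddPow (-z) k (mulX l (compOpp (u' ∘ₗ f) v)) p w}

/-- For integers `k, l`: `(x - z)^k x^l f Y^o(v,x) w ∈ U[x]` for all `w ∈ W`. -/
def PoleBound (z : ℂ) (f : W →ₗ[ℂ] U) (v : V) (k l : ℤ) : Prop :=
  ∀ w : W, IsPolynomial fun p => mulXAddPow (-z) k (mulX l (compOpp f v)) p w

open Classical in
/-- The series `Y^L_{P(z)}(v,x) f = (z + x)^{-l} ((x + z)^l f Y^o(v, x + z))`, where `(k, l)` is any
pair of integers as in `PoleBound` (the result does not depend on the pair). -/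
def leftAction (z : ℂ) (v : V) (f : W →ₗ[ℂ] U) : ℤ → W →ₗ[ℂ] U :=
  if h : ∃ q : ℤ × ℤ, PoleBound z f v q.1 q.2 then
    mulAddXPow z (-h.choose.2) (mulXAddPow z h.choose.2 (shift z (compOpp f v)))
  else 0

open Classical in
/-- The series `Y^R_{P(z)}(v,x) f = (-z + x)^{-k} ((x - z)^k f Y^o(v, x))`, where `(k, l)` is any
pair of integers as in `PoleBound` (the result does not depend on the pair). -/
def rightAction (z : ℂ) (v : V) (f : W →ₗ[ℂ] U) : ℤ → W →ₗ[ℂ] U :=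
  if h : ∃ q : ℤ × ℤ, PoleBound z f v q.1 q.2 then
    mulAddXPow (-z) (-h.choose.1) (mulXAddPow (-z) h.choose.1 (compOpp f v))
  else 0

/-- The mode `(u ⊗ v)_n f`, i.e. the coefficient of `x^(-n-1)` in
`Y_{P(z)}(u ⊗ v, x) f = Y^L(u, x) Y^R(v, x) f`; it is the sum of `u^L_i v^R_j f` over `i + j = n - 1`,
where `u^L_i` and `v^R_j` are the coefficients of `x^(-i-1)` and `x^(-j-1)`. On `D_{P(z)}(W,U)` only
finitely many terms are nonzero, as the two actions are lower truncated and commute. -/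
def tensorMode (z : ℂ) (u v : V) (n : ℤ) (f : W →ₗ[ℂ] U) : W →ₗ[ℂ] U :=
  ∑ᶠ i : ℤ, leftAction z u (rightAction z v f (-(n - 1 - i) - 1)) (-i - 1)

variable (V) in
/-- `Ω(D_{P(z)}(W,U))` for the weak `V ⊗ V`-module `D_{P(z)}(W,U)`: the elements `f` killed by all
modes `a_n` with `a ∈ V ⊗ V` homogeneous and `n ≥ wt a`. The homogeneous subspace of weight `N` of
`V ⊗ V` is spanned by the `u ⊗ v` with `u, v` homogeneous and `wt u + wt v = N`. -/
def Omega (W U : Type*) [AddCommGroup W] [Module ℂ W] [WeakModule V W]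
    [AddCommGroup U] [Module ℂ U] (z : ℂ) : Set (W →ₗ[ℂ] U) :=
  {f | f ∈ regular V W U z ∧ ∀ (r s : ℤ), ∀ u ∈ homog V r, ∀ v ∈ homog V s,
    ∀ n : ℤ, r + s ≤ n → tensorMode z u v n f = 0}

variable (V) in
/-- `O(W,z)`: the span of `Res_x x^{-2} (1 - z x)^{wt v} Y(v,x) w` for homogeneous `v`; this residue
is `∑_{i ≥ 0} (wt v choose i) (-z)^i v_{i-2} w`, a finite sum. -/
def zhuO (W : Type*) [AddCommGroup W] [Module ℂ W] [WeakModule V W] (z : ℂ) : Submodule ℂ W :=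
  Submodule.span ℂ {y | ∃ (n : ℤ), ∃ v ∈ homog V n, ∃ w : W,
    y = ∑ᶠ i : ℕ, ((Ring.choose n i : ℤ) * (-z) ^ i : ℂ) • mode W v (i - 2) w}

variable (V) in
/-- `A(W,z) = W / O(W,z)`. -/
abbrev ZhuA (W : Type*) [AddCommGroup W] [Module ℂ W] [WeakModule V W] (z : ℂ) : Type _ :=
  W ⧸ zhuO V W z

variable (V) in
/-- `Hom(A(W,z), U)`, viewed as a subspace of `Hom(W,U)` through the projection `W → A(W,z)`. -/
def homZhuA (W U : Type*) [AddCommGroup W] [Module ℂ W] [WeakModule V W]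
    [AddCommGroup U] [Module ℂ U] (z : ℂ) : Submodule ℂ (W →ₗ[ℂ] U) :=
  LinearMap.range (M := ZhuA V W z →ₗ[ℂ] U) (LinearMap.lcomp ℂ U (zhuO V W z).mkQ)

end Module

end VOA

end

/-!
Write `T_e(v)` for the operator `Res_x x^e (1 - z x)^(wt v) Y(v, x)` on `W` (`VOA.zhuMode`), so that
`O(W, z)` is spanned by the images of the `T_{-2}(v)`. Three conditions on `f : W → U` are compared:
`f` kills `O(W, z)`, `f ∈ Ω`, and "for homogeneous `v` of weight `n`, `f Y^o(v, x)` has poles of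
order at most `n` at `0` and at `z`", which is `PoleBound z f v n n`.

*Killing `O(W, z)` and poles.* Integrating the `L(-1)`-derivative property by parts expresses
`T_{e-1}(v)` through `T_e(L(-1) v)` and `T_e(v)`, so a map that kills `O(W, z)` kills the images of
all `T_e(v)` with `e ≤ -2` (`VOA.killsBelow_neg_two_iff`). On the other hand the coefficients of
`(x - z)^n f Y^o(v, x)` are combinations of the `f T_e(L(1)^i v)`, with `i = 0` contributing one
term with coefficient `±1` (`VOA.conv_opp`). As `L(1)` lowers weights and weights are bounded below,
the vanishing of one family of maps is equivalent to that of the other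
(`VOA.KillsBelow.poleBound`, `VOA.killsBelow_of_poleBound`).

*Poles and truncation of the two actions.* `Y^R(v, x) f` is the expansion of `f Y^o(v, x)` at
`x = 0` and `Y^L(v, x) f` its expansion at `x = z`. Hence the exponents at which these series start
are the orders of `f Y^o(v, x)` at the two points (`VOA.PoleBound.rightAction_eq_zero_iff`,
`VOA.PoleBound.leftAction_eq_zero_iff`). Applied to `v ⊗ 𝟏` and `𝟏 ⊗ v` this shows that `f ∈ Ω`
implies the pole bounds (`VOA.poleBound_of_mem_Omega`).

*From `O(W, z)` to `Ω`.* If `f` kills `O(W, z)`, then `v^R_j f = 0` for `j ≥ wt v`, and it remains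
to see that `u^L_i v^R_j f = 0` for `i ≥ wt u`. The map `g = v^R_j f` is a finite combination of maps
`f T_e(v')`. By the commutator formula, `T_e(v') T_a(u)` is `T_a(u) T_e(v')` up to operators
`T_b(u_t v')` with `b ≤ a + e + 1`, so `f T_e(v') T_a(u) = 0` once `a` is small, with a bound that
does not depend on `u` (`VOA.KillsBelow.comp_zhuMode`). By the argument above, `g Y^o(u, x)` then
has a pole of order at most `wt u` at `z` (and of some finite order at `0`), which is the claim.

Products of formal series are handled one vector at a time, as actions of scalar power series on
sequences that vanish at large indices (`VOA.conv`).
-/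

namespace VOA

noncomputable section

/-! ### Power series acting on truncated sequences -/

section Sequences

/-- The sequence vanishes at all large indices. -/
def UpperTruncated {E : Type*} [Zero E] (a : ℤ → E) : Prop := ∃ N : ℤ, ∀ q, N ≤ q → a q = 0

theorem UpperTruncated.exists_nat {E : Type*} [Zero E] {a : ℤ → E} (ha : UpperTruncated a) (q : ℤ) :
    ∃ M : ℕ, ∀ p, q + M ≤ p → a p = 0 := by
  obtain ⟨N, hN⟩ := ha
  exact ⟨(N - q).toNat, fun p hp => hN p (by lia)⟩

theorem UpperTruncated.comp_add {E : Type*} [Zero E] {a : ℤ → E} (ha : UpperTruncated a) (k : ℤ) :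
    UpperTruncated fun q => a (q + k) := by
  obtain ⟨N, hN⟩ := ha
  exact ⟨N - k, fun q hq => hN _ (by lia)⟩

theorem UpperTruncated.comp_sub {E : Type*} [Zero E] {a : ℤ → E} (ha : UpperTruncated a) (k : ℤ) :
    UpperTruncated fun q => a (q - k) := by
  simpa [sub_eq_add_neg] using ha.comp_add (-k)

theorem UpperTruncated.sum {E ι : Type*} [AddCommMonoid E] (s : Finset ι) {a : ι → ℤ → E}
    (ha : ∀ t ∈ s, UpperTruncated (a t)) : UpperTruncated fun q => ∑ t ∈ s, a t q := by
  classical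
  induction s using Finset.induction_on with
  | empty => exact ⟨0, by simp⟩
  | insert t s ht ih =>
    obtain ⟨N, hN⟩ := ih fun t' h => ha t' (Finset.mem_insert_of_mem h)
    obtain ⟨N', hN'⟩ := ha t (Finset.mem_insert_self _ _)
    refine ⟨max N N', fun q hq => ?_⟩
    simp only [Finset.sum_insert ht, hN' q (by lia), zero_add]
    exact hN q (by lia)

/-- Summation over the triangle `j + i < M` by antidiagonals. -/
theorem sum_range_antidiagonal {E : Type*} [AddCommMonoid E] (M : ℕ) (g : ℕ → ℕ → E) :
    ∑ n ∈ Finset.range M, ∑ ij ∈ Finset.HasAntidiagonal.antidiagonal n, g ij.1 ij.2 =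
      ∑ j ∈ Finset.range M, ∑ i ∈ Finset.range M, if j + i < M then g j i else 0 := by
  rw [← Finset.sum_product', ← Finset.sum_filter, Finset.sum_sigma']
  refine Finset.sum_bij' (fun x _ => x.2) (fun x _ => ⟨x.1 + x.2, x⟩) ?_ ?_ ?_ ?_ ?_
  · rintro ⟨n, i, j⟩ h
    simp at h ⊢
    lia
  · rintro ⟨i, j⟩ h
    simp at h ⊢
    lia
  · rintro ⟨n, i, j⟩ h
    simp at h ⊢
    lia
  · simp
  · simp

variable {E F : Type*} [AddCommGroup E] [Module ℂ E] [AddCommGroup F] [Module ℂ F]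

/-- The upper triangular operator with entries `γ q i` in row `q` and column `q + i`, on
sequences indexed by `ℤ`. -/
def triangular (γ : ℤ → ℕ → ℂ) (a : ℤ → E) (q : ℤ) : E := ∑ᶠ i : ℕ, γ q i • a (q + i)

/-- The action of a power series on sequences for which `X` is the shift `a ↦ a (· + 1)`. -/
def conv (α : PowerSeries ℂ) (a : ℤ → E) : ℤ → E := triangular (fun _ i => α.coeff i) a

theorem triangular_eq_sum {γ : ℤ → ℕ → ℂ} {a : ℤ → E} {q : ℤ} {M : ℕ}
    (h : ∀ p, q + M ≤ p → a p = 0) :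
    triangular γ a q = ∑ i ∈ Finset.range M, γ q i • a (q + i) := by
  refine finsum_eq_sum_of_support_subset _ fun i hi => ?_
  by_contra hc
  simp only [Finset.coe_range, Set.mem_Iio, not_lt] at hc
  exact hi (by simp only [h (q + i) (by lia), smul_zero])

theorem triangular_eq_zero {γ : ℤ → ℕ → ℂ} {a : ℤ → E} {q : ℤ}
    (h : ∀ p, q ≤ p → a p = 0) : triangular γ a q = 0 := by
  rw [triangular_eq_sum (M := 0) (by simpa using h)]
  simp

theorem UpperTruncated.triangular {a : ℤ → E} (ha : UpperTruncated a) (γ : ℤ → ℕ → ℂ) :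
    UpperTruncated (triangular γ a) := by
  obtain ⟨N, hN⟩ := ha
  exact ⟨N, fun q hq => triangular_eq_zero fun p hp => hN p (by lia)⟩

theorem UpperTruncated.conv {a : ℤ → E} (ha : UpperTruncated a) (α : PowerSeries ℂ) :
    UpperTruncated (conv α a) := ha.triangular _

theorem UpperTruncated.smul {a : ℤ → E} (ha : UpperTruncated a) (c : ℤ → ℂ) :
    UpperTruncated fun q => c q • a q := by
  obtain ⟨N, hN⟩ := ha
  exact ⟨N, fun q hq => by simp [hN q hq]⟩

theorem UpperTruncated.map {a : ℤ → E} (ha : UpperTruncated a) (f : E →ₗ[ℂ] F) :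
    UpperTruncated fun q => f (a q) := by
  obtain ⟨N, hN⟩ := ha
  exact ⟨N, fun q hq => by simp [hN q hq]⟩

/-- The product of two upper triangular operators. -/
theorem triangular_triangular (β γ : ℤ → ℕ → ℂ) {a : ℤ → E} (ha : UpperTruncated a) (q : ℤ) :
    triangular β (triangular γ a) q =
      ∑ᶠ n : ℕ, (∑ ij ∈ Finset.HasAntidiagonal.antidiagonal n,
        β q ij.1 * γ (q + ij.1) ij.2) • a (q + n) := by
  obtain ⟨M, hM⟩ := ha.exists_nat q
  have h1 : ∀ p, q + M ≤ p → triangular γ a p = 0 := fun p hp =>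
    triangular_eq_zero fun r hr => hM r (by lia)
  have h2 := triangular_eq_sum (γ := fun q n => ∑ ij ∈ Finset.HasAntidiagonal.antidiagonal n,
    β q ij.1 * γ (q + ij.1) ij.2) hM
  rw [triangular] at h2
  rw [triangular_eq_sum h1, h2]
  have h3 : ∀ n ∈ Finset.range M,
      (∑ ij ∈ Finset.HasAntidiagonal.antidiagonal n,
        β q ij.1 * γ (q + ij.1) ij.2) • a (q + n) =
      ∑ ij ∈ Finset.HasAntidiagonal.antidiagonal n,
        (β q ij.1 * γ (q + ij.1) ij.2) • a (q + ij.1 + ij.2) := by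
    intro n _
    rw [Finset.sum_smul]
    refine Finset.sum_congr rfl fun ij hij => ?_
    rw [Finset.HasAntidiagonal.mem_antidiagonal] at hij
    rw [← hij]
    push_cast
    rw [add_assoc]
  rw [Finset.sum_congr rfl h3,
    sum_range_antidiagonal M fun j i => (β q j * γ (q + j) i) • a (q + j + i)]
  refine Finset.sum_congr rfl fun j hj => ?_
  rw [triangular_eq_sum (M := M) fun p hp => hM p (by lia), Finset.smul_sum]
  refine Finset.sum_congr rfl fun i _ => ?_
  rw [smul_smul]
  split_ifs with hc
  · rfl
  · rw [hM (q + j + i) (by lia), smul_zero]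

theorem conv_mul (α β : PowerSeries ℂ) {a : ℤ → E} (ha : UpperTruncated a) :
    conv (α * β) a = conv α (conv β a) := by
  funext q
  rw [conv, conv, conv, triangular_triangular _ _ ha]
  simp only [triangular, PowerSeries.coeff_mul]

theorem conv_polynomial (P : Polynomial ℂ) {d : ℕ} (hd : P.natDegree ≤ d) (a : ℤ → E) (q : ℤ) :
    conv (P : PowerSeries ℂ) a q = ∑ i ∈ Finset.range (d + 1), P.coeff i • a (q + i) := by
  simp only [conv, triangular, Polynomial.coeff_coe]
  refine finsum_eq_sum_of_support_subset _ fun i hi => ?_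
  by_contra hc
  simp only [Finset.coe_range, Set.mem_Iio, not_lt] at hc
  exact hi (by simp only [P.coeff_eq_zero_of_natDegree_lt (n := i) (by lia), zero_smul])

theorem conv_one (a : ℤ → E) : conv 1 a = a := by
  funext q
  have := conv_polynomial (E := E) 1 (d := 0) (by simp) a q
  simpa using this

theorem conv_coeff_eq_sum {α : PowerSeries ℂ} {a : ℤ → E} {q : ℤ} {M : ℕ}
    (h : ∀ p, q + M ≤ p → a p = 0) :
    conv α a q = ∑ i ∈ Finset.range M, α.coeff i • a (q + i) := triangular_eq_sum h

theorem conv_add (α : PowerSeries ℂ) {a b : ℤ → E} (ha : UpperTruncated a)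
    (hb : UpperTruncated b) (q : ℤ) :
    conv α (fun p => a p + b p) q = conv α a q + conv α b q := by
  obtain ⟨M, hM⟩ := ha.exists_nat q
  obtain ⟨M', hM'⟩ := hb.exists_nat q
  rw [conv_coeff_eq_sum (M := max M M'), conv_coeff_eq_sum (M := max M M'),
    conv_coeff_eq_sum (M := max M M'), ← Finset.sum_add_distrib]
  · simp only [smul_add]
  · exact fun p hp => hM' p (by lia)
  · exact fun p hp => hM p (by lia)
  · exact fun p hp => by rw [hM p (by lia), hM' p (by lia), add_zero]

theorem conv_zero (α : PowerSeries ℂ) (q : ℤ) : conv α (fun _ => (0 : E)) q = 0 :=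
  triangular_eq_zero fun _ _ => rfl

theorem conv_sum {ι : Type*} (α : PowerSeries ℂ) (s : Finset ι) {a : ι → ℤ → E}
    (ha : ∀ t ∈ s, UpperTruncated (a t)) (q : ℤ) :
    conv α (fun p => ∑ t ∈ s, a t p) q = ∑ t ∈ s, conv α (a t) q := by
  classical
  induction s using Finset.induction_on with
  | empty => simp [conv_zero]
  | insert t s ht ih =>
    have h' : ∀ t' ∈ s, UpperTruncated (a t') := fun t' h => ha t' (Finset.mem_insert_of_mem h)
    simp only [Finset.sum_insert ht]
    rw [conv_add α (ha t (Finset.mem_insert_self _ _)) (UpperTruncated.sum s h'), ih h']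

theorem map_conv (α : PowerSeries ℂ) (f : E →ₗ[ℂ] F) {a : ℤ → E} (ha : UpperTruncated a) (q : ℤ) :
    conv α (fun p => f (a p)) q = f (conv α a q) := by
  obtain ⟨M, hM⟩ := ha.exists_nat q
  rw [conv_coeff_eq_sum (M := M) (fun p hp => by simp [hM p hp]), conv_coeff_eq_sum hM]
  simp

theorem conv_smul (α : PowerSeries ℂ) (c : ℂ) {a : ℤ → E} (ha : UpperTruncated a) (q : ℤ) :
    conv α (fun p => c • a p) q = c • conv α a q :=
  map_conv α (c • LinearMap.id) ha q

theorem conv_sub (α : PowerSeries ℂ) {a b : ℤ → E} (ha : UpperTruncated a)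
    (hb : UpperTruncated b) (q : ℤ) :
    conv α (fun p => a p - b p) q = conv α a q - conv α b q := by
  have h := conv_add α ha (hb.smul fun _ => (-1 : ℂ)) q
  rw [conv_smul α (-1) hb] at h
  simpa [sub_eq_add_neg] using h

theorem conv_comp_add (α : PowerSeries ℂ) (a : ℤ → E) (k q : ℤ) :
    conv α (fun p => a (p + k)) q = conv α a (q + k) := by
  simp only [conv, triangular]
  refine finsum_congr fun i => ?_
  rw [show q + i + k = q + k + i by ring]

theorem conv_comp_sub (α : PowerSeries ℂ) (a : ℤ → E) (k q : ℤ) :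
    conv α (fun p => a (p - k)) q = conv α a (q - k) := conv_comp_add α a (-k) q

theorem conv_add_left (α β : PowerSeries ℂ) {a : ℤ → E} (ha : UpperTruncated a) (q : ℤ) :
    conv (α + β) a q = conv α a q + conv β a q := by
  obtain ⟨M, hM⟩ := ha.exists_nat q
  simp only [conv_coeff_eq_sum hM, map_add, add_smul, Finset.sum_add_distrib]

theorem conv_smul_left (c : ℂ) (α : PowerSeries ℂ) {a : ℤ → E} (ha : UpperTruncated a) (q : ℤ) :
    conv (c • α) a q = c • conv α a q := by
  obtain ⟨M, hM⟩ := ha.exists_nat q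
  simp only [conv_coeff_eq_sum hM, map_smul, smul_eq_mul, mul_smul, Finset.smul_sum]

end Sequences

/-! ### Binomial series -/

section Binomial

/-- The power series `(1 + c X)^k` for an integer `k`. -/
def binom (c : ℂ) (k : ℤ) : PowerSeries ℂ :=
  PowerSeries.rescale c (PowerSeries.binomialSeries ℂ k)

theorem coeff_binom (c : ℂ) (k : ℤ) (i : ℕ) :
    (binom c k).coeff i = ((Ring.choose k i : ℤ) : ℂ) * c ^ i := by
  simp [binom, PowerSeries.coeff_rescale, mul_comm]

theorem binom_add (c : ℂ) (k l : ℤ) : binom c (k + l) = binom c k * binom c l := by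
  simp [binom, PowerSeries.binomialSeries_add]

theorem binom_zero (c : ℂ) : binom c 0 = 1 := by
  simp [binom, PowerSeries.binomialSeries_zero]

theorem binom_natCast (c : ℂ) (d : ℕ) :
    binom c d = (((1 + Polynomial.C c * Polynomial.X) ^ d : Polynomial ℂ) : PowerSeries ℂ) := by
  have h : PowerSeries.rescale c (PowerSeries.X : PowerSeries ℂ) =
      PowerSeries.C c * PowerSeries.X := by
    ext n
    rw [PowerSeries.coeff_rescale, PowerSeries.coeff_C_mul, PowerSeries.coeff_X]
    split_ifs with hn <;> simp [hn]
  rw [binom, PowerSeries.binomialSeries_nat, map_pow, map_add, map_one, h]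
  simp

theorem natDegree_binom_natCast_le (c : ℂ) (d : ℕ) :
    ((1 + Polynomial.C c * Polynomial.X) ^ d : Polynomial ℂ).natDegree ≤ d := by
  compute_degree

/-- The recursion `(k + 1) (q choose k + 1) = (q - k) (q choose k)`. -/
theorem succ_mul_choose (q : ℤ) (k : ℕ) :
    ((k : ℤ) + 1) * Ring.choose q (k + 1) = (q - k) * Ring.choose q k := by
  have h := Ring.choose_smul_choose q (Nat.le_succ k)
  rw [Nat.succ_eq_add_one, Nat.add_sub_cancel_left, Ring.choose_one_right,
    Nat.choose_succ_self_right] at h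
  rw [mul_comm (q - k), ← h]
  simp

/-- Negation of the upper index of a binomial coefficient. -/
theorem choose_eq_neg_one_pow_mul (r : ℤ) (i : ℕ) :
    Ring.choose r i = (-1) ^ i * Ring.choose (i - 1 - r) i := by
  have h := Ring.choose_neg (i - 1 - r : ℤ) i
  rw [show -((i : ℤ) - 1 - r) = r - i + 1 by ring] at h
  have h2 := Ring.choose_neg (-r : ℤ) i
  rw [neg_neg] at h2
  rw [h2, show -r + (i : ℤ) - 1 = i - 1 - r by ring, Units.smul_def, Int.negOnePow]
  simp

/-- `(q choose i) = 0` for `0 ≤ q < i`. -/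
theorem choose_eq_zero_of_lt {q : ℤ} {i : ℕ} (h0 : 0 ≤ q) (h : q < i) : Ring.choose q i = 0 := by
  lift q to ℕ using h0
  rw [Ring.choose_natCast, Nat.choose_eq_zero_of_lt (by lia)]
  rfl

theorem derivative_binom (c : ℂ) (k : ℤ) :
    PowerSeries.derivative ℂ (binom c k) = (k * c : ℂ) • binom c (k - 1) := by
  have h : ∀ i : ℕ, ((i : ℤ) + 1) * Ring.choose k (i + 1) = k * Ring.choose (k - 1) i := by
    intro i
    have h1 := Ring.choose_smul_choose k (k := 1) (n := i + 1) (by lia)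
    simpa using h1
  ext i
  rw [PowerSeries.coeff_derivative, map_smul, coeff_binom, coeff_binom, smul_eq_mul]
  have := congrArg (Int.cast : ℤ → ℂ) (h i)
  push_cast at this
  rw [pow_succ]
  linear_combination (c ^ i * c) * this

end Binomial

/-! ### Modes and the commutator formula -/

section Modes

variable {V W : Type*} [AddCommGroup V] [Module ℂ V] [VertexOperatorAlgebra V]
  [AddCommGroup W] [Module ℂ W] [WeakModule V W]

theorem ncoeff_upperTruncated {E : Type*} [AddCommGroup E] [Module ℂ E]
    (A : VertexOperator ℂ E) (w : E) :
    UpperTruncated fun q => VertexOperator.ncoeff A q w :=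
  ⟨-((HahnModule.of ℂ).symm (A w)).order, fun q hq =>
    VertexOperator.ncoeff_eq_zero_of_lt_order A q w (by lia)⟩

theorem mode_upperTruncated (v : V) (w : W) : UpperTruncated fun q => mode W v q w :=
  ncoeff_upperTruncated _ w

theorem mode_zero (q : ℤ) : mode W (0 : V) q = 0 := by simp [mode]

/-- The mode `u_t` acting on `V` itself. -/
def adMode (u : V) (t : ℤ) : Module.End ℂ V :=
  VertexOperator.ncoeff (VertexOperatorAlgebra.Y u) t

theorem JacobiIdentity.commutator {V W : Type*} [AddCommGroup V] [Module ℂ V] [AddCommGroup W]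
    [Module ℂ W] {b : V → ℤ → Module.End ℂ V} {a : V → ℤ → Module.End ℂ W}
    (h : JacobiIdentity b a) (u v : V) (m n : ℤ) (w : W) :
    a u m (a v n w) - a v n (a u m w) =
      ∑ᶠ i : ℕ, ((Ring.choose m i : ℤ) : ℂ) • a (b u i v) (m + n - i) w := by
  have h1 := h u v w 0 m n
  simp only [zero_add] at h1
  rw [← h1, finsum_eq_single _ 0]
  · simp
  · intro i hi
    rw [Ring.choose_zero_pos ℤ (Nat.pos_of_ne_zero hi)]
    simp

/-- The commutator formula `[u_m, v_n] = ∑_t (m choose t) (u_t v)_{m+n-t}`, truncated at an index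
`T` beyond which `u_t v = 0`. -/
theorem mode_commutator (u v : V) {T : ℕ} (hT : ∀ t : ℕ, T ≤ t → adMode u t v = 0)
    (m n : ℤ) (w : W) :
    mode W u m (mode W v n w) - mode W v n (mode W u m w) =
      ∑ t ∈ Finset.range T, ((Ring.choose m t : ℤ) : ℂ) •
        mode W (adMode u t v) (m + n - t) w := by
  rw [mode, mode, JacobiIdentity.commutator (WeakModule.jacobi (V := V) (W := W))]
  refine finsum_eq_sum_of_support_subset _ fun i hi => ?_
  by_contra hc
  simp only [Finset.coe_range, Set.mem_Iio, not_lt] at hc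
  refine hi ?_
  have := hT i hc
  rw [adMode] at this
  simp [this]

end Modes

/-! ### Weights -/

section Grading

variable {V : Type*} [AddCommGroup V] [Module ℂ V] [VertexOperatorAlgebra V]

theorem component_of_mem {n : ℤ} {v : V} (hv : v ∈ homog V n) (m : ℤ) :
    component v m = if m = n then v else 0 := by
  split_ifs with h
  · rw [h]
    exact DirectSum.decompose_of_mem_same _ hv
  · exact DirectSum.decompose_of_mem_ne _ hv (Ne.symm h)

theorem component_mem (v : V) (n : ℤ) : component v n ∈ homog V n :=
  SetLike.coe_mem _

theorem component_add (v v' : V) (n : ℤ) :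
    component (v + v') n = component v n + component v' n := by
  simp [component]

theorem component_smul (c : ℂ) (v : V) (n : ℤ) : component (c • v) n = c • component v n := by
  simp only [component, DirectSum.decompose_smul, DirectSum.smul_apply, Submodule.coe_smul]

theorem exists_sum_component (v : V) :
    ∃ S : Finset ℤ, (∀ n ∉ S, component v n = 0) ∧ ∑ n ∈ S, component v n = v := by
  classical
  refine ⟨DFinsupp.support (DirectSum.decompose (VertexOperatorAlgebra.grade (V := V)) v),
    fun n hn => ?_, DirectSum.sum_support_decompose _ v⟩
  rw [DFinsupp.notMem_support_iff] at hn
  simp [component, hn]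

theorem component_L_zero (v : V) (n : ℤ) :
    component (adMode (VertexOperatorAlgebra.conformal : V) 1 v) n = (n : ℂ) • component v n := by
  induction v using DirectSum.Decomposition.inductionOn (VertexOperatorAlgebra.grade (V := V)) with
  | zero => simp [component]
  | @homogeneous i m =>
    rw [adMode, VertexOperatorAlgebra.L_zero i (m : V) m.2,
      component_of_mem (Submodule.smul_mem _ _ m.2), component_of_mem m.2]
    split_ifs with h <;> simp [h]
  | add m m' h h' => rw [map_add, component_add, component_add, h, h', smul_add]

theorem eq_component_of_forall_ne {v : V} {n : ℤ} (h : ∀ m ≠ n, component v m = 0) :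
    component v n = v := by
  obtain ⟨S, hS, hv⟩ := exists_sum_component v
  exact (Finset.sum_eq_single n (fun m _ hm => h m hm) (hS n)).symm.trans hv

theorem mem_homog_of_L_zero {v : V} {n : ℤ}
    (h : adMode (VertexOperatorAlgebra.conformal : V) 1 v = (n : ℂ) • v) : v ∈ homog V n := by
  have h1 : component v n = v := by
    refine eq_component_of_forall_ne fun m hm => ?_
    have h2 := component_L_zero v m
    rw [h, component_smul, ← sub_eq_zero, ← sub_smul, smul_eq_zero, sub_eq_zero] at h2
    exact h2.resolve_left fun h4 => hm (by exact_mod_cast h4.symm)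
  rw [← h1]
  exact component_mem v n

/-- The mode `u_t` is homogeneous of degree `wt u - t - 1`. -/
theorem adMode_mem {r s : ℤ} {u v : V} (hu : u ∈ homog V r) (hv : v ∈ homog V s) (t : ℤ) :
    adMode u t v ∈ homog V (r + s - t - 1) := by
  apply mem_homog_of_L_zero
  have h := JacobiIdentity.commutator (VertexOperatorAlgebra.jacobi (V := V))
    VertexOperatorAlgebra.conformal u 1 t v
  rw [finsum_eq_sum_of_support_subset (s := Finset.range 2)] at h
  · rw [Finset.sum_range_succ, Finset.sum_range_one] at h
    simp only [Ring.choose_zero_right, Ring.choose_one_right, Nat.cast_zero, Nat.cast_one,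
      VertexOperatorAlgebra.L_neg_one, VertexOperatorAlgebra.L_zero _ _ hu,
      VertexOperatorAlgebra.L_zero _ _ hv, map_smul, LinearMap.smul_apply, Pi.smul_apply,
      Int.cast_one, one_smul, sub_eq_iff_eq_add] at h
    rw [adMode, adMode, h]
    rw [show (1 : ℤ) + t - 0 - 1 = t by ring, show (1 : ℤ) + t - 1 = t by ring, ← add_smul,
      ← add_smul]
    congr 1
    push_cast
    ring
  · intro i hi
    by_contra hc
    simp only [Finset.coe_range, Set.mem_Iio, not_lt] at hc
    exact hi (by simp only [choose_eq_zero_of_lt (q := 1) (i := i) (by lia) (by lia),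
      Int.cast_zero, zero_smul])

theorem L1_pow_mem {n : ℤ} {v : V} (hv : v ∈ homog V n) (i : ℕ) :
    (L1 V ^ i) v ∈ homog V (n - i) := by
  induction i with
  | zero => simpa using hv
  | succ i ih =>
    rw [pow_succ', Module.End.mul_apply]
    have h := adMode_mem VertexOperatorAlgebra.conformal_mem ih 2
    rwa [show (2 : ℤ) + (n - i) - 2 - 1 = n - ((i + 1 : ℕ) : ℤ) by push_cast; ring] at h

theorem exists_L1_pow_eq_zero {n : ℤ} {v : V} (hv : v ∈ homog V n) :
    ∃ I : ℕ, ∀ i, I ≤ i → (L1 V ^ i) v = 0 := by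
  obtain ⟨N, hN⟩ := VertexOperatorAlgebra.grade_eq_bot (V := V)
  refine ⟨(n - N + 1).toNat, fun i hi => ?_⟩
  have := L1_pow_mem hv i
  rw [homog, hN _ (by lia)] at this
  simpa using this

end Grading

/-! ### Residues and the subspace `O(W, z)` -/

section ZhuModes

variable {V W U : Type*} [AddCommGroup V] [Module ℂ V] [VertexOperatorAlgebra V]
  [AddCommGroup W] [Module ℂ W] [WeakModule V W] [AddCommGroup U] [Module ℂ U]

/-- The operator `Res_x α(x) x^e Y(v, x)` on `W`, for a power series `α`. -/
def resMode (W : Type*) [AddCommGroup W] [Module ℂ W] [WeakModule V W]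
    (α : PowerSeries ℂ) (v : V) (e : ℤ) : Module.End ℂ W where
  toFun w := conv α (fun q => mode W v q w) e
  map_add' w w' := by
    simp only [map_add]
    exact conv_add α (mode_upperTruncated v w) (mode_upperTruncated v w') e
  map_smul' c w := by
    simp only [map_smul, RingHom.id_apply]
    exact conv_smul α c (mode_upperTruncated v w) e

theorem resMode_apply (α : PowerSeries ℂ) (v : V) (e : ℤ) (w : W) :
    resMode W α v e w = conv α (fun q => mode W v q w) e := rfl

theorem conv_resMode (α β : PowerSeries ℂ) (v : V) (w : W) :
    conv α (fun e => resMode W β v e w) = fun e => resMode W (α * β) v e w := by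
  funext e
  simp only [resMode_apply, conv_mul α β (mode_upperTruncated v w)]

theorem resMode_upperTruncated (α : PowerSeries ℂ) (v : V) (w : W) :
    UpperTruncated fun e => resMode W α v e w :=
  (mode_upperTruncated v w).conv α

/-- The operator `Res_x x^e (1 - z x)^n Y(v, x)` on `W`; it is used when `v` has weight `n`, and
`O(W, z)` is spanned by the images of these operators for `e = -2`. -/
def zhuMode (W : Type*) [AddCommGroup W] [Module ℂ W] [WeakModule V W]
    (z : ℂ) (n : ℤ) (v : V) (e : ℤ) : Module.End ℂ W := resMode W (binom (-z) n) v e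

theorem resMode_polynomial_mul (P : Polynomial ℂ) {d : ℕ} (hd : P.natDegree ≤ d) (z : ℂ) (n : ℤ)
    (v : V) (e : ℤ) (w : W) :
    resMode W (P * binom (-z) n) v e w =
      ∑ i ∈ Finset.range (d + 1), P.coeff i • zhuMode W z n v (e + i) w := by
  rw [← congrFun (conv_resMode (P : PowerSeries ℂ) (binom (-z) n) v w) e, conv_polynomial P hd]
  rfl

variable (V) in
/-- The linear map `g` kills the images of `Res_x x^e (1 - z x)^(wt v) Y(v, x)` for all
homogeneous `v` and all `e ≤ E`. -/
def KillsBelow (z : ℂ) (g : W →ₗ[ℂ] U) (E : ℤ) : Prop :=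
  ∀ n : ℤ, ∀ v ∈ homog V n, ∀ e ≤ E, ∀ w : W, g (zhuMode W z n v e w) = 0

theorem KillsBelow.resMode_eq_zero {z : ℂ} {g : W →ₗ[ℂ] U} {E : ℤ} (h : KillsBelow V z g E)
    {P : Polynomial ℂ} {d : ℕ} (hd : P.natDegree ≤ d) {n : ℤ} {v : V} (hv : v ∈ homog V n)
    {e : ℤ} (he : e + d ≤ E) (w : W) : g (resMode W (P * binom (-z) n) v e w) = 0 := by
  rw [resMode_polynomial_mul P hd, map_sum]
  refine Finset.sum_eq_zero fun i hi => ?_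
  rw [Finset.mem_range] at hi
  rw [map_smul, h n v hv _ (by lia), smul_zero]

variable (V W) in
theorem zhuO_eq_span (z : ℂ) :
    zhuO V W z = Submodule.span ℂ {y | ∃ (n : ℤ), ∃ v ∈ homog V n, ∃ w : W,
      y = zhuMode W z n v (-2) w} := by
  have h : ∀ (n : ℤ) (v : V) (w : W), zhuMode W z n v (-2) w =
      ∑ᶠ i : ℕ, ((Ring.choose n i : ℤ) * (-z) ^ i : ℂ) • mode W v (i - 2) w := by
    intro n v w
    rw [zhuMode, resMode_apply, conv, triangular]
    refine finsum_congr fun i => ?_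
    rw [coeff_binom, show (-2 : ℤ) + i = i - 2 by ring]
  simp only [h]
  rfl

/-- The `L(-1)`-derivative property, integrated by parts against `x^e (1 - z x)^(n+1)`. -/
theorem zhuMode_L_neg_one (z : ℂ) (n : ℤ) (v : V) (e : ℤ) (w : W) :
    zhuMode W z (n + 1) (adMode VertexOperatorAlgebra.conformal 0 v) e w =
      (-e : ℂ) • zhuMode W z n v (e - 1) w + ((e + n + 1) * z : ℂ) • zhuMode W z n v e w := by
  have h0 : ∀ q, mode W (adMode (VertexOperatorAlgebra.conformal : V) 0 v) q w =
      (-q : ℂ) • mode W v (q - 1) w := fun q => by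
    rw [mode, adMode, WeakModule.L_neg_one]
    rfl
  have hv := mode_upperTruncated v w
  have h1 : (PowerSeries.mk fun i : ℕ => -((e : ℂ) + i) * (binom (-z) (n + 1)).coeff i) =
      (-e : ℂ) • binom (-z) n + ((e + n + 1) * z : ℂ) • (PowerSeries.X * binom (-z) n) := by
    have h2 : binom (-z) (n + 1) = binom (-z) n - z • (PowerSeries.X * binom (-z) n) := by
      have h3 := binom_natCast (-z) 1
      rw [Nat.cast_one] at h3
      rw [add_comm, binom_add, h3, PowerSeries.smul_eq_C_mul]
      simp only [Polynomial.C_neg, pow_one, Polynomial.coe_add, Polynomial.coe_one,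
        Polynomial.coe_mul, Polynomial.coe_neg, Polynomial.coe_C, Polynomial.coe_X]
      ring
    ext i
    rw [PowerSeries.coeff_mk]
    rcases i with _ | i
    · have h4 : PowerSeries.constantCoeff (binom (-z) n) = 1 := by
        rw [← PowerSeries.coeff_zero_eq_constantCoeff_apply, coeff_binom]
        simp
      simp [coeff_binom, h4]
    · have h4 := congrArg (PowerSeries.coeff i) (derivative_binom (-z) (n + 1))
      rw [PowerSeries.coeff_derivative] at h4
      rw [h2] at h4 ⊢
      simp only [map_sub, map_smul, smul_eq_mul, PowerSeries.coeff_succ_X_mul, map_add,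
        add_sub_cancel_right] at h4 ⊢
      push_cast at h4 ⊢
      linear_combination -h4
  calc zhuMode W z (n + 1) (adMode VertexOperatorAlgebra.conformal 0 v) e w
      = conv (PowerSeries.mk fun i : ℕ => -((e : ℂ) + i) * (binom (-z) (n + 1)).coeff i)
          (fun q => mode W v q w) (e - 1) := by
        rw [zhuMode, resMode_apply, conv, conv, triangular, triangular]
        refine finsum_congr fun i => ?_
        rw [h0, PowerSeries.coeff_mk, smul_smul, show e + (i : ℤ) - 1 = e - 1 + i by ring]
        congr 1
        push_cast
        ring
    _ = _ := by
        rw [h1, conv_add_left _ _ hv, conv_smul_left _ _ hv, conv_smul_left _ _ hv, conv_mul _ _ hv]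
        congr 2
        have := conv_polynomial Polynomial.X (d := 1) (by simp)
          (conv (binom (-z) n) fun q => mode W v q w) (e - 1)
        simpa [Finset.sum_range_succ, Polynomial.coeff_X, zhuMode, resMode_apply] using this

/-- `O(W, z)` contains the images of `Res_x x^e (1 - z x)^(wt v) Y(v, x)` for all `e ≤ -2`: replace
`v` by `L(-1) v` to lower `e`. -/
theorem killsBelow_neg_two_iff (z : ℂ) (f : W →ₗ[ℂ] U) :
    KillsBelow V z f (-2) ↔ ∀ y ∈ zhuO V W z, f y = 0 := by
  rw [zhuO_eq_span]
  constructor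
  · intro h y hy
    have : Submodule.span ℂ {y | ∃ (n : ℤ), ∃ v ∈ homog V n, ∃ w : W,
        y = zhuMode W z n v (-2) w} ≤ LinearMap.ker f := by
      rw [Submodule.span_le]
      rintro _ ⟨n, v, hv, w, rfl⟩
      exact h n v hv (-2) le_rfl w
    exact this hy
  · intro h
    have key : ∀ m : ℕ, ∀ n : ℤ, ∀ v ∈ homog V n, ∀ w : W,
        f (zhuMode W z n v (-2 - m) w) = 0 := by
      intro m
      induction m with
      | zero => exact fun n v hv w => h _ (Submodule.subset_span ⟨n, v, hv, w, by simp⟩)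
      | succ m ih =>
        intro n v hv w
        have hL := adMode_mem VertexOperatorAlgebra.conformal_mem hv 0
        rw [show (2 : ℤ) + n - 0 - 1 = n + 1 by ring] at hL
        have h1 := ih (n + 1) _ hL w
        rw [zhuMode_L_neg_one, map_add, map_smul, map_smul, ih n v hv w, smul_zero, add_zero,
          smul_eq_zero] at h1
        rw [show (-2 : ℤ) - ((m + 1 : ℕ) : ℤ) = -2 - m - 1 by push_cast; ring]
        refine h1.resolve_left fun h2 => ?_
        rw [neg_eq_zero, Int.cast_eq_zero] at h2
        lia
    intro n v hv e he w
    have := key (-2 - e).toNat n v hv w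
    rwa [show -2 - (((-2 - e).toNat : ℕ) : ℤ) = e by lia] at this

theorem mem_homZhuA_iff (z : ℂ) (f : W →ₗ[ℂ] U) :
    f ∈ homZhuA V W U z ↔ KillsBelow V z f (-2) := by
  rw [killsBelow_neg_two_iff]
  constructor
  · rintro ⟨g, rfl⟩ y hy
    simp [(Submodule.Quotient.mk_eq_zero _).2 hy]
  · intro h
    exact ⟨(zhuO V W z).liftQ f h, LinearMap.ext fun w => (zhuO V W z).liftQ_apply f (h := h) w⟩

end ZhuModes

/-! ### The opposite vertex operator -/

section Opposite

variable {V W U : Type*} [AddCommGroup V] [Module ℂ V] [VertexOperatorAlgebra V]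
  [AddCommGroup W] [Module ℂ W] [WeakModule V W] [AddCommGroup U] [Module ℂ U]

theorem opp_of_mem {n : ℤ} {v : V} (hv : v ∈ homog V n) {I : ℕ}
    (hI : ∀ i, I ≤ i → (L1 V ^ i) v = 0) (p : ℤ) :
    opp W v p = ∑ i ∈ Finset.range I, ((-1 : ℂ) ^ n / (i.factorial : ℂ)) •
      mode W ((L1 V ^ i) v) (p - 1 - i + 2 * n) := by
  rw [opp, finsum_eq_single _ n]
  · simp only [component_of_mem hv, if_pos]
    refine finsum_eq_sum_of_support_subset _ fun i hi => ?_
    by_contra hc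
    simp only [Finset.coe_range, Set.mem_Iio, not_lt] at hc
    exact hi (by simp only [hI i hc, mode_zero, smul_zero])
  · intro m hm
    simp [component_of_mem hv, hm, mode_zero]

theorem opp_eq_sum_component (v : V) {S : Finset ℤ} (hS : ∀ n ∉ S, component v n = 0) (p : ℤ) :
    opp W v p = ∑ n ∈ S, opp W (component v n) p := by
  have h : ∀ n, opp W (component v n) p = ∑ᶠ i : ℕ, ((-1 : ℂ) ^ n / (i.factorial : ℂ)) •
      mode W ((L1 V ^ i) (component v n)) (p - 1 - i + 2 * n) := by
    intro n
    rw [opp, finsum_eq_single _ n]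
    · simp only [component_of_mem (component_mem v n), if_pos]
    · intro m hm
      simp [component_of_mem (component_mem v n), hm, mode_zero]
  simp only [h]
  rw [opp]
  refine finsum_eq_sum_of_support_subset _ fun n hn => ?_
  by_contra hc
  exact hn (by simp [hS n hc, mode_zero])

theorem opp_upperTruncated (v : V) (w : W) : UpperTruncated fun p => opp W v p w := by
  obtain ⟨S, hS, -⟩ := exists_sum_component v
  simp only [opp_eq_sum_component v hS, LinearMap.sum_apply]
  refine UpperTruncated.sum S fun n _ => ?_
  obtain ⟨I, hI⟩ := exists_L1_pow_eq_zero (component_mem v n)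
  simp only [opp_of_mem (component_mem v n) hI, LinearMap.sum_apply, LinearMap.smul_apply]
  refine UpperTruncated.sum _ fun i _ => UpperTruncated.smul ?_ _
  have := (mode_upperTruncated ((L1 V ^ i) (component v n)) w).comp_add (2 * n - 1 - i)
  simpa only [show ∀ p : ℤ, p + (2 * n - 1 - i) = p - 1 - i + 2 * n from fun p => by ring]
    using this

/-- For `v` of weight `n`, the coefficients of `(1 - z x⁻¹)^n Y^o(v, x)` are combinations of the
operators `Res_x x^e (1 - z x)^n Y(L(1)^i v, x)`. The factor `(1 - z x)^n` is split as
`(1 - z x)^i (1 - z x)^(n-i)`, since `n - i` is the weight of `L(1)^i v`. -/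
theorem conv_opp (z : ℂ) {n : ℤ} {v : V} (hv : v ∈ homog V n) {I : ℕ}
    (hI : ∀ i, I ≤ i → (L1 V ^ i) v = 0) (w : W) (q : ℤ) :
    conv (binom (-z) n) (fun p => opp W v p w) q =
      ∑ i ∈ Finset.range I, ((-1 : ℂ) ^ n / (i.factorial : ℂ)) •
        resMode W (((1 + Polynomial.C (-z) * Polynomial.X) ^ i : Polynomial ℂ) *
          binom (-z) (n - i)) ((L1 V ^ i) v) (q + 2 * n - 1 - i) w := by
  have ht : ∀ i : ℕ, UpperTruncated fun p =>
      mode W ((L1 V ^ i) v) (p - 1 - i + 2 * n) w := fun i => by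
    have := (mode_upperTruncated ((L1 V ^ i) v) w).comp_add (2 * n - 1 - i)
    simpa only [show ∀ p : ℤ, p + (2 * n - 1 - i) = p - 1 - i + 2 * n from fun p => by ring]
      using this
  simp only [opp_of_mem hv hI, LinearMap.sum_apply, LinearMap.smul_apply]
  rw [conv_sum _ _ fun i _ => (ht i).smul _]
  refine Finset.sum_congr rfl fun i _ => ?_
  rw [conv_smul _ _ (ht i), ← binom_natCast, ← binom_add, add_sub_cancel, resMode_apply]
  have h := conv_comp_add (binom (-z) n) (fun q => mode W ((L1 V ^ i) v) q w) (2 * n - 1 - i) q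
  simp only [show ∀ p : ℤ, p + (2 * n - 1 - i) = p - 1 - i + 2 * n from fun p => by ring] at h
  rw [h, show q + 2 * n - 1 - i = q - 1 - i + 2 * n by ring]

end Opposite

/-! ### Products and substitutions of formal series -/

section SeriesProducts

theorem lowerTruncated_of_forall_lt {E : Type*} [Zero E] {b : ℤ → E} {N : ℤ}
    (h : ∀ p < N, b p = 0) : UpperTruncated fun q => b (-q) := ⟨1 - N, fun q hq => h _ (by lia)⟩

variable {E : Type*} [AddCommGroup E] [Module ℂ E]

/-- The product `(x + c)^k a(x)` for an upper truncated series `a(x) = ∑ a_p x^p`; here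
`(x + c)^k = x^k (1 + c x⁻¹)^k`. -/
def xAdd (c : ℂ) (k : ℤ) (a : ℤ → E) (p : ℤ) : E := conv (binom c k) a (p - k)

/-- The product `(c + x)^k b(x)` for a lower truncated series `b(x) = ∑ b_p x^p`; here
`(c + x)^k = c^k (1 + c⁻¹ x)^k`. That `b` is lower truncated is expressed as the upper truncation
of `q ↦ b (-q)`. -/
def addX (c : ℂ) (k : ℤ) (b : ℤ → E) (p : ℤ) : E :=
  c ^ k • conv (binom c⁻¹ k) (fun q => b (-q)) (-p)

/-- The series `a(x + c)`, for an upper truncated series `a(x) = ∑ a_p x^p`. -/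
def shiftSeq (c : ℂ) (a : ℤ → E) : ℤ → E :=
  triangular (fun p i => ((Ring.choose (p + i) i : ℤ) : ℂ) * c ^ i) a

theorem UpperTruncated.xAdd {a : ℤ → E} (ha : UpperTruncated a) (c : ℂ) (k : ℤ) :
    UpperTruncated (xAdd c k a) := (ha.conv (binom c k)).comp_sub k

theorem UpperTruncated.shiftSeq {a : ℤ → E} (ha : UpperTruncated a) (c : ℂ) :
    UpperTruncated (shiftSeq c a) := ha.triangular _

theorem xAdd_xAdd (c : ℂ) (k l : ℤ) {a : ℤ → E} (ha : UpperTruncated a) :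
    xAdd c k (xAdd c l a) = xAdd c (k + l) a := by
  funext p
  rw [xAdd, xAdd, binom_add, conv_mul _ _ ha]
  exact (conv_comp_sub _ _ l (p - k)).trans (by rw [sub_sub])

theorem xAdd_comp_sub (c : ℂ) (k l : ℤ) (a : ℤ → E) (p : ℤ) :
    xAdd c k (fun q => a (q - l)) p = xAdd c k a (p - l) := by
  rw [xAdd, xAdd, conv_comp_sub, sub_right_comm]

theorem addX_zero (c : ℂ) (b : ℤ → E) : addX c 0 b = b := by
  funext p
  simp [addX, binom_zero, conv_one]

theorem addX_addX {c : ℂ} (hc : c ≠ 0) (k l : ℤ) {b : ℤ → E}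
    (hb : UpperTruncated fun q => b (-q)) : addX c k (addX c l b) = addX c (k + l) b := by
  funext p
  simp only [addX, neg_neg]
  rw [conv_smul _ _ (hb.conv _), smul_smul, ← zpow_add₀ hc, binom_add, conv_mul _ _ hb]

theorem addX_eq_zero (c : ℂ) (k : ℤ) {b : ℤ → E} {N : ℤ} (h : ∀ p < N, b p = 0) {p : ℤ}
    (hp : p < N) : addX c k b p = 0 := by
  rw [addX, conv, triangular_eq_zero (fun q hq => h _ (by lia)), smul_zero]

theorem addX_eq_zero_iff {c : ℂ} (hc : c ≠ 0) (k : ℤ) {b : ℤ → E}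
    (hb : UpperTruncated fun q => b (-q)) {N : ℤ} :
    (∀ p < N, addX c k b p = 0) ↔ ∀ p < N, b p = 0 := by
  refine ⟨fun h p hp => ?_, fun h p hp => addX_eq_zero c k h hp⟩
  have h1 := addX_eq_zero c (-k) h hp
  rwa [addX_addX hc _ _ hb, neg_add_cancel, addX_zero] at h1

theorem conv_binom_natCast (c : ℂ) (m : ℕ) (a : ℤ → E) (q : ℤ) :
    conv (binom c m) a q =
      ∑ i ∈ Finset.range (m + 1), ((m.choose i : ℂ) * c ^ i) • a (q + i) := by
  have h : ∀ i, (binom c m).coeff i = (m.choose i : ℂ) * c ^ i := fun i => by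
    rw [coeff_binom, Ring.choose_natCast, Int.cast_natCast]
  rw [binom_natCast, conv_polynomial _ (natDegree_binom_natCast_le c m)]
  refine Finset.sum_congr rfl fun i _ => ?_
  rw [← h, binom_natCast, Polynomial.coeff_coe]

/-- For a nonnegative exponent the expansions of `(x + c)^m` and `(c + x)^m` agree. -/
theorem xAdd_natCast {c : ℂ} (hc : c ≠ 0) (m : ℕ) (b : ℤ → E) :
    xAdd c m b = addX c m b := by
  funext p
  rw [xAdd, addX, conv_binom_natCast, conv_binom_natCast, Finset.smul_sum, ← Finset.sum_flip]
  refine Finset.sum_congr rfl fun i hi => ?_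
  rw [Finset.mem_range] at hi
  have hi' : i ≤ m := by lia
  rw [smul_smul, Nat.choose_symm hi', show p - m + ((m - i : ℕ) : ℤ) = -(-p + i) by lia]
  congr 1
  rw [zpow_natCast, inv_pow, pow_sub₀ c hc hi']
  ring

/-- The series `(c + x)^(-k) ((x + c)^k a(x))` is the same for all `k` for which
`(x + c)^k a(x)` is a Laurent polynomial. -/
theorem addX_neg_xAdd_eq {c : ℂ} (hc : c ≠ 0) {a : ℤ → E} (ha : UpperTruncated a) {k k' : ℤ}
    (hk : UpperTruncated fun q => xAdd c k a (-q))
    (hk' : UpperTruncated fun q => xAdd c k' a (-q)) :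
    addX c (-k) (xAdd c k a) = addX c (-k') (xAdd c k' a) := by
  have key : ∀ (k : ℤ) (d : ℕ), (UpperTruncated fun q => xAdd c k a (-q)) →
      addX c (-(d + k)) (xAdd c (d + k) a) = addX c (-k) (xAdd c k a) := by
    intro k d h
    rw [← xAdd_xAdd c d k ha, xAdd_natCast hc, addX_addX hc _ _ h, neg_add_rev,
      neg_add_cancel_right]
  rcases le_total k k' with h | h
  · rw [← key k (k' - k).toNat hk, show ((k' - k).toNat : ℤ) + k = k' by lia]
  · rw [← key k' (k - k').toNat hk', show ((k - k').toNat : ℤ) + k' = k by lia]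

/-- The Vandermonde identity behind `a(x) ↦ (x + c)^l a(x + c)`. -/
theorem choose_sum_add (l q : ℤ) (n : ℕ) :
    ∑ ij ∈ Finset.HasAntidiagonal.antidiagonal n,
      Ring.choose l ij.1 * Ring.choose (q + ij.1 + ij.2) ij.2 = Ring.choose (q + l + n) n := by
  rw [show q + l + n = l + (q + n) by ring, Ring.add_choose_eq n (Commute.all l (q + n))]
  refine Finset.sum_congr rfl fun ij h => ?_
  rw [Finset.HasAntidiagonal.mem_antidiagonal] at h
  rw [← h, Nat.cast_add, add_assoc]

/-- The Vandermonde identity behind the substitution of `x + c` in `(x - c)^k a(x)`. -/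
theorem choose_sum_sub (k q : ℤ) (n : ℕ) :
    ∑ ij ∈ Finset.HasAntidiagonal.antidiagonal n,
      Ring.choose (q + ij.1) ij.1 * (Ring.choose k ij.2 * (-1) ^ ij.2) =
        Ring.choose (q - k + n) n := by
  rw [choose_eq_neg_one_pow_mul, show (n : ℤ) - 1 - (q - k + n) = (-1 - q) + k by ring,
    Ring.add_choose_eq n (Commute.all _ _), Finset.mul_sum]
  refine Finset.sum_congr rfl fun ij h => ?_
  rw [Finset.HasAntidiagonal.mem_antidiagonal] at h
  rw [choose_eq_neg_one_pow_mul (q + ij.1), ← h,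
    show (ij.1 : ℤ) - 1 - (q + ij.1) = -1 - q by ring, pow_add]
  ring

/-- Substituting `x + c` for `x` turns multiplication by `x^l` into multiplication by
`(x + c)^l`. -/
theorem shiftSeq_comp_sub (c : ℂ) (l : ℤ) {a : ℤ → E} (ha : UpperTruncated a) :
    shiftSeq c (fun q => a (q - l)) = xAdd c l (shiftSeq c a) := by
  funext p
  rw [xAdd, conv, shiftSeq, shiftSeq, triangular_triangular _ _ ha, triangular]
  refine finsum_congr fun n => ?_
  rw [show p + (n : ℤ) - l = p - l + n by ring]
  congr 1
  have h := congrArg (Int.cast : ℤ → ℂ) (choose_sum_add l (p - l) n)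
  rw [sub_add_cancel] at h
  rw [← h, Int.cast_sum, Finset.sum_mul]
  refine Finset.sum_congr rfl fun ij hij => ?_
  rw [Finset.HasAntidiagonal.mem_antidiagonal] at hij
  rw [coeff_binom, ← hij, pow_add]
  push_cast
  ring

/-- Substituting `x + c` for `x` turns multiplication by `(x - c)^k` into multiplication by
`x^k`. -/
theorem shiftSeq_xAdd_neg (c : ℂ) (k : ℤ) {a : ℤ → E} (ha : UpperTruncated a) (p : ℤ) :
    shiftSeq c (xAdd (-c) k a) p = shiftSeq c a (p - k) := by
  have h0 : xAdd (-c) k a = triangular (fun _ i => (binom (-c) k).coeff i) fun q => a (q - k) := by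
    funext q
    exact (conv_comp_sub _ a k q).symm
  rw [h0, shiftSeq, triangular_triangular _ _ (ha.comp_sub k), shiftSeq, triangular]
  refine finsum_congr fun n => ?_
  rw [show p + (n : ℤ) - k = p - k + n by ring]
  congr 1
  rw [← choose_sum_sub k p n, Int.cast_sum, Finset.sum_mul]
  refine Finset.sum_congr rfl fun ij hij => ?_
  rw [Finset.HasAntidiagonal.mem_antidiagonal] at hij
  rw [coeff_binom, ← hij, pow_add, neg_pow c]
  push_cast
  ring

/-- The series `a(x)` has no negative powers if and only if `a(x + c)` has none. -/
theorem shiftSeq_eq_zero_iff (c : ℂ) (a : ℤ → E) :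
    (∀ p < 0, shiftSeq c a p = 0) ↔ ∀ p < 0, a p = 0 := by
  -- Only the diagonal term contributes to the coefficient of the highest negative power.
  have key : ∀ p < 0, (∀ q, p < q → q < 0 → a q = 0) → shiftSeq c a p = a p := by
    intro p hp h
    rw [shiftSeq, triangular, finsum_eq_single _ 0]
    · simp
    · intro i hi
      rcases lt_or_ge (p + i) 0 with h1 | h1
      · rw [h _ (by lia) h1, smul_zero]
      · rw [choose_eq_zero_of_lt h1 (by lia), Int.cast_zero, zero_mul, zero_smul]
  constructor
  · intro h
    have : ∀ m : ℕ, ∀ p < 0, -(m : ℤ) ≤ p → a p = 0 := by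
      intro m
      induction m with
      | zero => exact fun p h1 h2 => by lia
      | succ m ih =>
        intro p h1 h2
        rw [← key p h1 fun q h3 h4 => ih q h4 (by push_cast at h2; lia)]
        exact h p h1
    exact fun p hp => this (-p).toNat p hp (by lia)
  · intro h p hp
    rw [key p hp fun q _ hq => h q hq, h p hp]

/-- The order of `(x + c)^l a(x + c)` at `x = 0` is the order of `a(x)` at `x = c`. -/
theorem xAdd_shiftSeq_eq_zero_iff (c : ℂ) (l n : ℤ) {a : ℤ → E} (ha : UpperTruncated a) :
    (∀ p < -n, xAdd c l (shiftSeq c a) p = 0) ↔ ∀ p < -l, xAdd (-c) n a p = 0 := by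
  have h1 := shiftSeq_eq_zero_iff c (xAdd (-c) n fun q => a (q - l))
  simp only [shiftSeq_xAdd_neg c n (ha.comp_sub l), xAdd_comp_sub, shiftSeq_comp_sub c l ha] at h1
  constructor
  · intro h p hp
    have := h1.1 (fun q hq => h _ (by lia)) (p + l) (by lia)
    rwa [add_sub_cancel_right] at this
  · intro h p hp
    have := h1.2 (fun q hq => h _ (by lia)) (p + n) (by lia)
    rwa [add_sub_cancel_right] at this

end SeriesProducts

/-! ### Pole bounds and the left and right actions -/

section Actions

variable {W U : Type*} [AddCommGroup W] [Module ℂ W] [AddCommGroup U] [Module ℂ U]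

theorem locSum_apply {ι : Type*} {g : ι → W →ₗ[ℂ] U}
    (h : ∀ w, (Function.support fun i => g i w).Finite) (w : W) :
    locSum g w = ∑ᶠ i, g i w := by
  rw [locSum, dif_pos h]
  rfl

theorem finite_support_of_upperTruncated {a : ℤ → U} (ha : UpperTruncated a) (q : ℤ)
    (γ : ℕ → ℂ) : (Function.support fun i : ℕ => γ i • a (q + i)).Finite := by
  obtain ⟨M, hM⟩ := ha.exists_nat q
  refine (Finset.range M).finite_toSet.subset fun i hi => ?_
  by_contra hc
  simp only [Finset.coe_range, Set.mem_Iio, not_lt] at hc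
  exact hi (by simp only [hM (q + i) (by lia), smul_zero])

theorem mulXAddPow_apply (c : ℂ) (k : ℤ) {A : ℤ → W →ₗ[ℂ] U}
    (hA : ∀ w, UpperTruncated fun p => A p w) (p : ℤ) (w : W) :
    mulXAddPow c k A p w = xAdd c k (fun q => A q w) p := by
  rw [mulXAddPow, locSum_apply]
  · simp only [LinearMap.smul_apply, xAdd, conv, triangular, coeff_binom]
  · exact fun w => finite_support_of_upperTruncated (hA w) _ _

theorem shift_apply (c : ℂ) {A : ℤ → W →ₗ[ℂ] U}
    (hA : ∀ w, UpperTruncated fun p => A p w) (p : ℤ) (w : W) :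
    shift c A p w = shiftSeq c (fun q => A q w) p := by
  rw [shift, locSum_apply]
  · rfl
  · exact fun w => finite_support_of_upperTruncated (hA w) _ _

theorem mulAddXPow_apply {c : ℂ} (hc : c ≠ 0) (k : ℤ) {A : ℤ → W →ₗ[ℂ] U}
    (hA : ∀ w, UpperTruncated fun p => A (-p) w) (p : ℤ) (w : W) :
    mulAddXPow c k A p w = addX c k (fun q => A q w) p := by
  have h : ∀ i : ℕ, p - (i : ℤ) = -(-p + i) := fun i => by ring
  simp only [mulAddXPow, h]
  rw [locSum_apply]
  · rw [addX, ← conv_smul _ _ (hA w), conv, triangular]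
    refine finsum_congr fun i => ?_
    rw [LinearMap.smul_apply, smul_smul, coeff_binom, zpow_sub₀ hc, zpow_natCast, inv_pow]
    congr 1
    ring
  · exact fun w => finite_support_of_upperTruncated (hA w) _ _

variable {V : Type*} [AddCommGroup V] [Module ℂ V] [VertexOperatorAlgebra V] [WeakModule V W]

theorem compOpp_upperTruncated (f : W →ₗ[ℂ] U) (v : V) (w : W) :
    UpperTruncated fun p => compOpp f v p w := (opp_upperTruncated v w).map f

theorem mulXAddPow_mulX_compOpp (z : ℂ) (f : W →ₗ[ℂ] U) (v : V) (k l p : ℤ) (w : W) :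
    mulXAddPow (-z) k (mulX l (compOpp f v)) p w =
      xAdd (-z) k (fun q => compOpp f v q w) (p - l) := by
  exact (mulXAddPow_apply (A := mulX l (compOpp f v)) _ _
    (fun w => (compOpp_upperTruncated f v w).comp_sub l) p w).trans
    (xAdd_comp_sub _ _ l (fun q => compOpp f v q w) p)

/-- As `Y^o(v, x) w` is upper truncated, only the vanishing of the coefficients of negative powers
matters in `PoleBound`. -/
theorem poleBound_iff {z : ℂ} {f : W →ₗ[ℂ] U} {v : V} {k l : ℤ} :
    PoleBound z f v k l ↔
      ∀ w, ∀ p < -l, xAdd (-z) k (fun q => compOpp f v q w) p = 0 := by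
  simp only [PoleBound, IsPolynomial, mulXAddPow_mulX_compOpp]
  constructor
  · intro h w p hp
    have := (h w).1 (p + l) (by lia)
    rwa [add_sub_cancel_right] at this
  · intro h w
    have h0 : ∀ p < 0, xAdd (-z) k (fun q => compOpp f v q w) (p - l) = 0 :=
      fun p hp => h w _ (by lia)
    refine ⟨h0, ?_⟩
    obtain ⟨N, hN⟩ := ((compOpp_upperTruncated f v w).xAdd (-z) k).comp_sub l
    refine (Finset.Ico 0 N).finite_toSet.subset fun p hp => ?_
    by_contra hc
    rw [Finset.coe_Ico, Set.mem_Ico, not_and_or, not_le, not_lt] at hc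
    exact hp (hc.elim (h0 p) (hN p))

variable {z : ℂ} {f : W →ₗ[ℂ] U} {v : V} {k l : ℤ}

/-- The Laurent polynomial `(x - z)^k f Y^o(v, x) w`. -/
theorem PoleBound.right_lowerTruncated (h : PoleBound z f v k l) (w : W) :
    UpperTruncated fun q => xAdd (-z) k (fun q => compOpp f v q w) (-q) :=
  lowerTruncated_of_forall_lt (poleBound_iff.1 h w)

/-- The Laurent polynomial `(x + z)^l f Y^o(v, x + z) w`. -/
theorem PoleBound.left_lowerTruncated (h : PoleBound z f v k l) (w : W) :
    UpperTruncated fun q => xAdd z l (shiftSeq z fun q => compOpp f v q w) (-q) :=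
  lowerTruncated_of_forall_lt
    ((xAdd_shiftSeq_eq_zero_iff z l k (compOpp_upperTruncated f v w)).2 (poleBound_iff.1 h w))

/-- The right action is computed by any pair of exponents as in `PoleBound`. -/
theorem PoleBound.rightAction_apply (hz : z ≠ 0) (h : PoleBound z f v k l) (p : ℤ) (w : W) :
    rightAction z v f p w = addX (-z) (-k) (xAdd (-z) k fun q => compOpp f v q w) p := by
  have hex : ∃ q : ℤ × ℤ, PoleBound z f v q.1 q.2 := ⟨(k, l), h⟩
  have hA := mulXAddPow_apply (-z) hex.choose.1 (compOpp_upperTruncated f v)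
  rw [rightAction, dif_pos hex, mulAddXPow_apply (neg_ne_zero.2 hz)]
  · simp only [hA]
    exact congrFun (addX_neg_xAdd_eq (neg_ne_zero.2 hz) (compOpp_upperTruncated f v w)
      (hex.choose_spec.right_lowerTruncated w) (h.right_lowerTruncated w)) p
  · simp only [hA]
    exact hex.choose_spec.right_lowerTruncated

theorem mulXAddPow_shift_compOpp (z : ℂ) (l : ℤ) (f : W →ₗ[ℂ] U) (v : V) (p : ℤ) (w : W) :
    mulXAddPow z l (shift z (compOpp f v)) p w =
      xAdd z l (shiftSeq z fun q => compOpp f v q w) p := by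
  have h := shift_apply z (compOpp_upperTruncated f v)
  rw [mulXAddPow_apply]
  · simp only [h]
  · simp only [h]
    exact fun w => (compOpp_upperTruncated f v w).shiftSeq z

/-- The left action is computed by any pair of exponents as in `PoleBound`. -/
theorem PoleBound.leftAction_apply (hz : z ≠ 0) (h : PoleBound z f v k l) (p : ℤ) (w : W) :
    leftAction z v f p w = addX z (-l) (xAdd z l (shiftSeq z fun q => compOpp f v q w)) p := by
  have hex : ∃ q : ℤ × ℤ, PoleBound z f v q.1 q.2 := ⟨(k, l), h⟩
  rw [leftAction, dif_pos hex, mulAddXPow_apply hz]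
  · simp only [mulXAddPow_shift_compOpp]
    exact congrFun (addX_neg_xAdd_eq hz ((compOpp_upperTruncated f v w).shiftSeq z)
      (hex.choose_spec.left_lowerTruncated w) (h.left_lowerTruncated w)) p
  · simp only [mulXAddPow_shift_compOpp]
    exact hex.choose_spec.left_lowerTruncated

/-- The order of the pole of `f Y^o(v, x)` at `x = 0` is the order of truncation of
`Y^R(v, x) f`. -/
theorem PoleBound.rightAction_eq_zero_iff (hz : z ≠ 0) (h : PoleBound z f v k l) (n : ℤ) :
    (∀ p < -n, rightAction z v f p = 0) ↔ PoleBound z f v k n := by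
  rw [poleBound_iff]
  simp only [LinearMap.ext_iff, LinearMap.zero_apply, h.rightAction_apply hz]
  exact ⟨fun h1 w => (addX_eq_zero_iff (neg_ne_zero.2 hz) _ (h.right_lowerTruncated w)).1
      fun p hp => h1 p hp w,
    fun h1 p hp w => (addX_eq_zero_iff (neg_ne_zero.2 hz) _ (h.right_lowerTruncated w)).2
      (h1 w) p hp⟩

/-- The order of the pole of `f Y^o(v, x)` at `x = z` is the order of truncation of
`Y^L(v, x) f`. -/
theorem PoleBound.leftAction_eq_zero_iff (hz : z ≠ 0) (h : PoleBound z f v k l) (n : ℤ) :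
    (∀ p < -n, leftAction z v f p = 0) ↔ PoleBound z f v n l := by
  rw [poleBound_iff]
  simp only [LinearMap.ext_iff, LinearMap.zero_apply, h.leftAction_apply hz,
    ← xAdd_shiftSeq_eq_zero_iff z l n (compOpp_upperTruncated f v _)]
  exact ⟨fun h1 w => (addX_eq_zero_iff hz _ (h.left_lowerTruncated w)).1
      fun p hp => h1 p hp w,
    fun h1 p hp w => (addX_eq_zero_iff hz _ (h.left_lowerTruncated w)).2 (h1 w) p hp⟩

theorem PoleBound.mulAddXPow_rightAction (hz : z ≠ 0) (h : PoleBound z f v k l) :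
    mulAddXPow (-z) k (rightAction z v f) = mulXAddPow (-z) k (compOpp f v) := by
  have hz' := neg_ne_zero.2 hz
  have h1 := fun w => poleBound_iff.1 h w
  ext p w
  rw [mulAddXPow_apply hz', mulXAddPow_apply _ _ (compOpp_upperTruncated f v)]
  · simp only [h.rightAction_apply hz]
    rw [addX_addX hz' _ _ (h.right_lowerTruncated w), add_neg_cancel, addX_zero]
  · intro w
    simp only [h.rightAction_apply hz]
    exact lowerTruncated_of_forall_lt fun p hp => addX_eq_zero _ _ (h1 w) hp

theorem PoleBound.mulAddXPow_leftAction (hz : z ≠ 0) (h : PoleBound z f v k l) :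
    mulAddXPow z l (leftAction z v f) = mulXAddPow z l (shift z (compOpp f v)) := by
  have h1 := fun w => (xAdd_shiftSeq_eq_zero_iff z l k (compOpp_upperTruncated f v w)).2
    (poleBound_iff.1 h w)
  ext p w
  rw [mulAddXPow_apply hz, mulXAddPow_shift_compOpp]
  · simp only [h.leftAction_apply hz]
    rw [addX_addX hz _ _ (h.left_lowerTruncated w), add_neg_cancel, addX_zero]
  · intro w
    simp only [h.leftAction_apply hz]
    exact lowerTruncated_of_forall_lt fun p hp => addX_eq_zero _ _ (h1 w) hp

theorem PoleBound.mono (h : PoleBound z f v k l) {k' l' : ℤ} (hk : k ≤ k') (hl : l ≤ l') :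
    PoleBound z f v k' l' := by
  rw [poleBound_iff] at h ⊢
  intro w p hp
  rw [show k' = ((k' - k).toNat : ℤ) + k by lia,
    ← xAdd_xAdd _ _ _ (compOpp_upperTruncated f v w), xAdd, conv_binom_natCast]
  refine Finset.sum_eq_zero fun i hi => ?_
  rw [Finset.mem_range] at hi
  rw [h w _ (by lia), smul_zero]

end Actions

/-! ### Pole bounds for maps that kill residues -/

section PoleBounds

variable {V W U : Type*} [AddCommGroup V] [Module ℂ V] [VertexOperatorAlgebra V]
  [AddCommGroup W] [Module ℂ W] [WeakModule V W] [AddCommGroup U] [Module ℂ U]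
  {z : ℂ} {f : W →ₗ[ℂ] U}

theorem xAdd_compOpp (c : ℂ) (k : ℤ) (f : W →ₗ[ℂ] U) (v : V) (w : W) (p : ℤ) :
    xAdd c k (fun q => compOpp f v q w) p =
      f (conv (binom c k) (fun q => opp W v q w) (p - k)) :=
  map_conv _ f (opp_upperTruncated v w) _

/-- The case `E = -2` bounds both poles by `wt v`. For smaller `E` only the pole at `0` gets worse:
the bound at `z` is still `wt v`. -/
theorem KillsBelow.poleBound {E : ℤ} (h : KillsBelow V z f E) {n : ℤ} {v : V}
    (hv : v ∈ homog V n) : PoleBound z f v n (n - 2 - E) := by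
  obtain ⟨I, hI⟩ := exists_L1_pow_eq_zero hv
  rw [poleBound_iff]
  intro w p hp
  rw [xAdd_compOpp, conv_opp z hv hI, map_sum]
  refine Finset.sum_eq_zero fun i _ => ?_
  rw [map_smul, h.resMode_eq_zero (natDegree_binom_natCast_le (-z) i) (L1_pow_mem hv i)
    (by lia), smul_zero]

/-- Modulo homogeneous vectors of lower weight, `Y^o(v, x)` is `± x^(-2 wt v) Y(v, x⁻¹)`, so
induction on the weight recovers `Y(v, x)` from `Y^o(v, x)`. -/
theorem killsBelow_of_poleBound (h : ∀ n : ℤ, ∀ v ∈ homog V n, PoleBound z f v n n) :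
    KillsBelow V z f (-2) := by
  obtain ⟨N, hN⟩ := VertexOperatorAlgebra.grade_eq_bot (V := V)
  have key : ∀ m : ℕ, ∀ n < N + m, ∀ v ∈ homog V n, ∀ e ≤ -2, ∀ w : W,
      f (zhuMode W z n v e w) = 0 := by
    intro m
    induction m with
    | zero =>
      intro n hn v hv e _ w
      rw [homog, hN n (by simpa using hn), Submodule.mem_bot] at hv
      simp only [hv, zhuMode, resMode_apply, mode_zero, LinearMap.zero_apply, conv_zero, map_zero]
    | succ m ih =>
      intro n hn v hv e he w
      obtain ⟨I, hI⟩ := exists_L1_pow_eq_zero hv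
      -- In the expansion of this coefficient, the term `i = 0` is the one in question.
      have h1 := poleBound_iff.1 (h n v hv) w (e + 1 - n) (by lia)
      rw [xAdd_compOpp, conv_opp z hv (I := I + 1) (fun i hi => hI i (by lia)),
        Finset.sum_range_succ', map_add, map_sum, Finset.sum_eq_zero, zero_add, map_smul,
        smul_eq_zero] at h1
      · have h2 : (-1 : ℂ) ^ n / ((Nat.factorial 0 : ℕ) : ℂ) ≠ 0 := by
          simp [zpow_ne_zero]
        have h3 := h1.resolve_left h2
        rw [pow_zero, pow_zero, Polynomial.coe_one, one_mul, Module.End.one_apply,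
          Nat.cast_zero, sub_zero, sub_zero,
          show e + 1 - n - n + 2 * n - 1 = e by ring] at h3
        exact h3
      · intro i _
        rw [map_smul, resMode_polynomial_mul _ (natDegree_binom_natCast_le (-z) (i + 1)), map_sum,
          Finset.sum_eq_zero, smul_zero]
        intro j hj
        rw [Finset.mem_range] at hj
        rw [map_smul, ih _ (by push_cast at hn ⊢; lia) _ (L1_pow_mem hv (i + 1)) _
          (by push_cast; lia), smul_zero]
  exact fun n v hv e he w => key (n - N + 1).toNat n (by lia) v hv e he w

/-- In the definition of `regular` the functionals on `U` can be dropped: they separate the points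
of `U`, and `Y^o(v, x) w` is upper truncated. -/
theorem mem_regular_iff :
    f ∈ regular V W U z ↔ ∀ v : V, ∃ k l : ℕ, PoleBound z f v k l := by
  have h : f ∈ regular V W U z ↔ ∀ v : V, ∃ k l : ℕ, ∀ u' : Module.Dual ℂ U,
      PoleBound z (u' ∘ₗ f) v k l := Iff.rfl
  rw [h]
  refine forall_congr' fun v => exists_congr fun k => exists_congr fun l => ?_
  simp only [poleBound_iff, xAdd_compOpp, LinearMap.comp_apply]
  constructor
  · exact fun h w p hp => (Module.forall_dual_apply_eq_zero_iff ℂ _).1 fun u' => h u' w p hp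
  · exact fun h u' w p hp => by rw [h w p hp, map_zero]

theorem poleBound_of_component {v : V} {S : Finset ℤ} (hS : ∀ n ∉ S, component v n = 0) {k l : ℤ}
    (h : ∀ n ∈ S, PoleBound z f (component v n) k l) : PoleBound z f v k l := by
  simp only [poleBound_iff, xAdd_compOpp] at h ⊢
  intro w p hp
  simp only [opp_eq_sum_component v hS, LinearMap.sum_apply]
  rw [conv_sum _ _ fun n _ => opp_upperTruncated (component v n) w, map_sum]
  exact Finset.sum_eq_zero fun n hn => h n hn w p hp

theorem KillsBelow.mem_regular {E : ℤ} (h : KillsBelow V z f E) : f ∈ regular V W U z := by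
  rw [mem_regular_iff]
  intro v
  obtain ⟨S, hS, -⟩ := exists_sum_component v
  refine ⟨S.sup Int.toNat, S.sup fun n => (n - 2 - E).toNat, poleBound_of_component hS ?_⟩
  intro n hn
  have h1 := Finset.le_sup (f := Int.toNat) hn
  have h2 := Finset.le_sup (f := fun n : ℤ => (n - 2 - E).toNat) hn
  exact (h.poleBound (component_mem v n)).mono (by lia) (by lia)

end PoleBounds

/-! ### Commutators of residues -/

section Commutator

variable {V W U : Type*} [AddCommGroup V] [Module ℂ V] [VertexOperatorAlgebra V]
  [AddCommGroup W] [Module ℂ W] [WeakModule V W] [AddCommGroup U] [Module ℂ U]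

/-- The power series `x^(t-a)` times the `t`-th divided derivative of `x^a α(x)`. -/
def hasseCoeff (α : PowerSeries ℂ) (a : ℤ) (t : ℕ) : PowerSeries ℂ :=
  PowerSeries.mk fun j => ((Ring.choose (a + j) t : ℤ) : ℂ) * α.coeff j

/-- The commutator formula for residues:
`[Res_x x^a α(x) Y(u, x), Res_y y^e β(y) Y(v, y)]` is the sum over `t` of
`Res_y y^e β(y) (∂^t / t!)(y^a α(y)) Y(u_t v, y)`. -/
theorem resMode_commutator (α β : PowerSeries ℂ) (u v : V) {T : ℕ}
    (hT : ∀ t : ℕ, T ≤ t → adMode u t v = 0) (a e : ℤ) (w : W) :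
    resMode W α u a (resMode W β v e w) - resMode W β v e (resMode W α u a w) =
      ∑ t ∈ Finset.range T,
        resMode W (β * hasseCoeff α a t) (adMode u t v) (e + (a - t)) w := by
  have h1 : ∀ n, resMode W α u a (mode W v n w) - mode W v n (resMode W α u a w) =
      ∑ t ∈ Finset.range T, resMode W (hasseCoeff α a t) (adMode u t v) (n + (a - t)) w := by
    intro n
    have hu := mode_upperTruncated u w
    have ht : ∀ t : ℕ, UpperTruncated fun m =>
        mode W (adMode u t v) (m + n - t) w := fun t => by
      have := (mode_upperTruncated (adMode u t v) w).comp_add (n - t)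
      simpa only [← add_sub_assoc] using this
    rw [resMode_apply, resMode_apply, ← map_conv α (mode W v n) hu,
      ← conv_sub α (mode_upperTruncated u _) (hu.map (mode W v n))]
    simp only [mode_commutator u v hT]
    rw [conv_sum _ _ fun t _ => (ht t).smul _]
    refine Finset.sum_congr rfl fun t _ => ?_
    rw [resMode_apply, conv, conv, triangular, triangular]
    refine finsum_congr fun j => ?_
    rw [hasseCoeff, PowerSeries.coeff_mk, smul_smul, mul_comm,
      show n + (a - t) + j = a + j + n - t by ring]
  have hv := mode_upperTruncated v w
  rw [resMode_apply β v e w, resMode_apply β v e, ← map_conv β _ hv,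
    ← conv_sub β (hv.map _) (mode_upperTruncated v _)]
  simp only [h1]
  rw [conv_sum _ _ fun t _ => (resMode_upperTruncated _ _ w).comp_add _]
  refine Finset.sum_congr rfl fun t _ => ?_
  have h2 := conv_comp_add β (fun n => resMode W (hasseCoeff α a t) (adMode u t v) n w) (a - t) e
  rw [conv_resMode] at h2
  exact h2

/-- The `t`-th derivative of `x^a (1 + c x)^r` is `x^(a-t) (1 + c x)^(r-t)` times a polynomial of
degree at most `t`. -/
theorem exists_hasseCoeff_binom (c : ℂ) (r a : ℤ) (t : ℕ) :
    ∃ P : Polynomial ℂ, P.natDegree ≤ t ∧ hasseCoeff (binom c r) a t = P * binom c (r - t) := by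
  induction t with
  | zero =>
    refine ⟨1, by simp, ?_⟩
    ext j
    simp [hasseCoeff]
  | succ t ih =>
    obtain ⟨P, hP, h⟩ := ih
    have hb : binom c (r - t) = (1 + PowerSeries.C c * PowerSeries.X) * binom c (r - t - 1) := by
      have h3 := binom_natCast c 1
      rw [Nat.cast_one] at h3
      rw [show r - (t : ℤ) = 1 + (r - t - 1) by ring, binom_add, h3]
      simp
    have hrec : ((t : ℂ) + 1) • hasseCoeff (binom c r) a (t + 1) =
        ((a : ℂ) - t) • hasseCoeff (binom c r) a t +
          PowerSeries.X * PowerSeries.derivative ℂ (hasseCoeff (binom c r) a t) := by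
      ext j
      have h1 := congrArg (Int.cast : ℤ → ℂ) (succ_mul_choose (a + j) t)
      push_cast at h1
      rcases j with _ | j
      · simp only [hasseCoeff, map_smul, map_add, PowerSeries.coeff_mk, smul_eq_mul,
          PowerSeries.coeff_zero_X_mul, add_zero] at h1 ⊢
        push_cast at h1 ⊢
        linear_combination (PowerSeries.coeff 0 (binom c r)) * h1
      · simp only [hasseCoeff, map_smul, map_add, PowerSeries.coeff_mk, smul_eq_mul,
          PowerSeries.coeff_succ_X_mul, PowerSeries.coeff_derivative] at h1 ⊢
        push_cast at h1 ⊢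
        linear_combination (PowerSeries.coeff (j + 1) (binom c r)) * h1
    rw [h, Derivation.leibniz, derivative_binom, hb, PowerSeries.derivative_coe] at hrec
    refine ⟨((t : ℂ) + 1)⁻¹ • (((a : ℂ) - t) • ((1 + Polynomial.C c * Polynomial.X) * P) +
      (1 + Polynomial.C c * Polynomial.X) * (Polynomial.X * Polynomial.derivative P) +
      (((r : ℂ) - t) * c) • (Polynomial.X * P)), ?_, ?_⟩
    · have hlin : (1 + Polynomial.C c * Polynomial.X : Polynomial ℂ).natDegree ≤ 1 := by
        compute_degree
      have hX : (Polynomial.X * Polynomial.derivative P).natDegree ≤ t := by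
        rcases t with _ | t
        · rw [Polynomial.derivative_of_natDegree_zero (by lia)]
          simp
        · refine Polynomial.natDegree_mul_le.trans ?_
          have := Polynomial.natDegree_derivative_le P
          rw [Polynomial.natDegree_X]
          lia
      refine (Polynomial.natDegree_smul_le _ _).trans ?_
      refine Polynomial.natDegree_add_le_of_degree_le (Polynomial.natDegree_add_le_of_degree_le
        ((Polynomial.natDegree_smul_le _ _).trans ?_) ?_)
        ((Polynomial.natDegree_smul_le _ _).trans ?_)
      · exact Polynomial.natDegree_mul_le.trans (by lia)
      · exact Polynomial.natDegree_mul_le.trans (by lia)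
      · refine Polynomial.natDegree_mul_le.trans ?_
        rw [Polynomial.natDegree_X]
        lia
    · have ht : ((t : ℂ) + 1) ≠ 0 := by exact_mod_cast Nat.succ_ne_zero t
      rw [← inv_smul_smul₀ ht (hasseCoeff (binom c r) a (t + 1)), hrec,
        show r - ((t + 1 : ℕ) : ℤ) = r - t - 1 by push_cast; ring]
      simp only [smul_eq_mul, PowerSeries.smul_eq_C_mul, Polynomial.smul_eq_C_mul,
        Polynomial.coe_mul, Polynomial.coe_add, Polynomial.coe_C, Polynomial.coe_X,
        Polynomial.coe_one, Int.cast_sub, Int.cast_natCast]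
      ring

/-- If `f` kills `O(W, z)`, then `f ∘ Res_x x^e (1 - z x)^(wt v) Y(v, x)` kills the images of
`Res_x x^a (1 - z x)^(wt u) Y(u, x)` for `a` sufficiently negative, with a bound that does not
depend on `u`. -/
theorem KillsBelow.comp_zhuMode {z : ℂ} {f : W →ₗ[ℂ] U} (h : KillsBelow V z f (-2)) {s : ℤ} {v : V}
    (hv : v ∈ homog V s) (e : ℤ) :
    KillsBelow V z (f ∘ₗ zhuMode W z s v e) (min (-2) (-3 - e)) := by
  intro r u hu a ha w
  obtain ⟨T, hT⟩ := (ncoeff_upperTruncated (VertexOperatorAlgebra.Y u) v).exists_nat 0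
  have hc := resMode_commutator (binom (-z) r) (binom (-z) s) u v (T := T)
    (fun t ht => hT t (by lia)) a e w
  have h1 : f (resMode W (binom (-z) r) u a (resMode W (binom (-z) s) v e w)) = 0 :=
    h r u hu a (by lia) _
  have h2 := congrArg f hc
  rw [map_sub, h1, zero_sub, map_sum, Finset.sum_eq_zero, neg_eq_zero] at h2
  · exact h2
  intro t _
  obtain ⟨P, hP, hPt⟩ := exists_hasseCoeff_binom (-z) r a t
  -- The power of `1 - z x` exceeds the weight `r + s - t - 1` of `u_t v` by one.
  have h3 : binom (-z) s * hasseCoeff (binom (-z) r) a t =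
      ((P * (1 + Polynomial.C (-z) * Polynomial.X) ^ 1 : Polynomial ℂ) : PowerSeries ℂ) *
        binom (-z) (r + s - t - 1) := by
    rw [hPt, Polynomial.coe_mul, ← binom_natCast, mul_left_comm, ← binom_add, mul_assoc,
      ← binom_add]
    congr 2
    push_cast
    ring
  rw [h3]
  exact h.resMode_eq_zero (d := t + 1)
    (Polynomial.natDegree_mul_le.trans (add_le_add hP (natDegree_binom_natCast_le _ _)))
    (adMode_mem hu hv t) (by push_cast; lia) w

variable (V) in
/-- The linear maps that kill the images of `Res_x x^e (1 - z x)^(wt v) Y(v, x)` for all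
homogeneous `v` and all `e` below some bound. -/
def eventuallyKills (W U : Type*) [AddCommGroup W] [Module ℂ W] [WeakModule V W]
    [AddCommGroup U] [Module ℂ U] (z : ℂ) : Submodule ℂ (W →ₗ[ℂ] U) where
  carrier := {g | ∃ E, KillsBelow V z g E}
  zero_mem' := ⟨0, fun _ _ _ _ _ _ => rfl⟩
  add_mem' := by
    rintro g g' ⟨E, h⟩ ⟨E', h'⟩
    exact ⟨min E E', fun n v hv e he w => by
      rw [LinearMap.add_apply, h n v hv e (by lia) w, h' n v hv e (by lia) w, add_zero]⟩
  smul_mem' := by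
    rintro c g ⟨E, h⟩
    exact ⟨E, fun n v hv e he w => by rw [LinearMap.smul_apply, h n v hv e he w, smul_zero]⟩

/-- The modes `v^R_j f` of an element `f` of `Hom(A(W, z), U)` are finite combinations of maps
`f ∘ Res_x x^e (1 - z x)^(wt v') Y(v', x)`. -/
theorem KillsBelow.rightAction_mem {z : ℂ} (hz : z ≠ 0) {f : W →ₗ[ℂ] U}
    (h : KillsBelow V z f (-2)) {s : ℤ} {v : V} (hv : v ∈ homog V s) (p : ℤ) :
    rightAction z v f p ∈ eventuallyKills V W U z := by
  have hpole := h.poleBound hv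
  obtain ⟨I, hI⟩ := exists_L1_pow_eq_zero hv
  obtain ⟨M, hM⟩ : ∃ M : ℕ, p + s < M := ⟨(p + s + 1).toNat, by lia⟩
  have heq : rightAction z v f p = (-z) ^ (-s) • ∑ j ∈ Finset.range M,
      (binom (-z)⁻¹ (-s)).coeff j • ∑ i ∈ Finset.range I,
        ((-1 : ℂ) ^ s / (i.factorial : ℂ)) • ∑ m ∈ Finset.range (i + 1),
          ((1 + Polynomial.C (-z) * Polynomial.X : Polynomial ℂ) ^ i).coeff m •
            (f ∘ₗ zhuMode W z (s - i) ((L1 V ^ i) v) (p - j - s + 2 * s - 1 - i + m)) := by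
    ext w
    rw [hpole.rightAction_apply hz, addX, conv_coeff_eq_sum (M := M)
      fun q hq => poleBound_iff.1 hpole w _ (by lia)]
    simp only [LinearMap.smul_apply, LinearMap.sum_apply, LinearMap.comp_apply]
    congr 1
    refine Finset.sum_congr rfl fun j _ => ?_
    rw [xAdd_compOpp, conv_opp z hv hI, map_sum, show -(-p + (j : ℤ)) = p - j by ring]
    congr 1
    refine Finset.sum_congr rfl fun i _ => ?_
    rw [map_smul, resMode_polynomial_mul _ (natDegree_binom_natCast_le (-z) i), map_sum]
    simp only [map_smul]
  rw [heq]
  exact Submodule.smul_mem _ _ (Submodule.sum_mem _ fun j _ => Submodule.smul_mem _ _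
    (Submodule.sum_mem _ fun i _ => Submodule.smul_mem _ _ (Submodule.sum_mem _ fun m _ =>
      Submodule.smul_mem _ _ ⟨_, h.comp_zhuMode (L1_pow_mem hv i) _⟩)))

end Commutator

/-! ### The space `Ω` -/

section Omega

variable {V W U : Type*} [AddCommGroup V] [Module ℂ V] [VertexOperatorAlgebra V]
  [AddCommGroup W] [Module ℂ W] [WeakModule V W] [AddCommGroup U] [Module ℂ U] {z : ℂ}

theorem leftAction_zero (hz : z ≠ 0) (v : V) : leftAction z v (0 : W →ₗ[ℂ] U) = 0 := by
  have h : ∀ k, PoleBound z (0 : W →ₗ[ℂ] U) v k 0 := fun k => poleBound_iff.2 fun w p _ => by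
    rw [xAdd_compOpp, LinearMap.zero_apply]
  funext p
  exact ((h 0).leftAction_eq_zero_iff hz (-p - 1)).2 (h _) p (by lia)

theorem KillsBelow.mem_Omega (hz : z ≠ 0) {f : W →ₗ[ℂ] U} (h : KillsBelow V z f (-2)) :
    f ∈ Omega V W U z := by
  refine ⟨h.mem_regular, fun r s u hu v hv n hn => ?_⟩
  rw [tensorMode, finsum_eq_zero_of_forall_eq_zero]
  intro i
  -- Either `v^R_j f = 0` because `j ≥ s`, or `i ≥ r` and `u^L_i` kills `v^R_j f`.
  rcases lt_or_ge (-(n - 1 - i) - 1) (-s) with hi | hi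
  · have hp : PoleBound z f v s s := (h.poleBound hv).mono le_rfl (by lia)
    rw [(hp.rightAction_eq_zero_iff hz s).2 hp _ hi, leftAction_zero hz]
    rfl
  · obtain ⟨E, hE⟩ := h.rightAction_mem hz hv (-(n - 1 - i) - 1)
    have hp := hE.poleBound hu
    exact (hp.leftAction_eq_zero_iff hz r).2 hp _ (by lia)

theorem opp_vacuum (p : ℤ) :
    opp W (VertexOperatorAlgebra.vacuum : V) p = if p = 0 then 1 else 0 := by
  rw [opp_of_mem VertexOperatorAlgebra.vacuum_mem (I := 1)]
  · simp only [Finset.sum_range_one, zpow_zero, Nat.factorial_zero, Nat.cast_one, div_one, one_smul,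
      pow_zero, Module.End.one_apply, Nat.cast_zero, mode, WeakModule.vacuum_mode]
    congr 1
    simp only [eq_iff_iff]
    lia
  · intro i hi
    obtain ⟨j, rfl⟩ := Nat.exists_eq_succ_of_ne_zero (show i ≠ 0 by lia)
    rw [pow_succ, Module.End.mul_apply, L1, VertexOperatorAlgebra.mode_vacuum _ _ (by lia),
      map_zero]

theorem compOpp_vacuum (f : W →ₗ[ℂ] U) (p : ℤ) (w : W) :
    compOpp f (VertexOperatorAlgebra.vacuum : V) p w = if p = 0 then f w else 0 := by
  rw [compOpp, LinearMap.comp_apply, opp_vacuum]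
  split_ifs <;> simp

theorem poleBound_vacuum (f : W →ₗ[ℂ] U) :
    PoleBound z f (VertexOperatorAlgebra.vacuum : V) 0 0 := by
  rw [poleBound_iff]
  intro w p hp
  rw [xAdd, binom_zero, conv_one, compOpp_vacuum, if_neg (by lia)]

theorem rightAction_vacuum (hz : z ≠ 0) (f : W →ₗ[ℂ] U) (p : ℤ) :
    rightAction z (VertexOperatorAlgebra.vacuum : V) f p = if p = 0 then f else 0 := by
  ext w
  rw [(poleBound_vacuum f).rightAction_apply hz, neg_zero, addX_zero, xAdd, binom_zero, conv_one,
    sub_zero, compOpp_vacuum]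
  split_ifs <;> rfl

theorem leftAction_vacuum (hz : z ≠ 0) (f : W →ₗ[ℂ] U) (p : ℤ) :
    leftAction z (VertexOperatorAlgebra.vacuum : V) f p = if p = 0 then f else 0 := by
  ext w
  rw [(poleBound_vacuum f).leftAction_apply hz, neg_zero, addX_zero, xAdd, binom_zero, conv_one,
    sub_zero, shiftSeq, triangular, finsum_eq_single _ 0]
  · rw [compOpp_vacuum]
    split_ifs <;> simp_all
  · intro i hi
    rw [compOpp_vacuum]
    split_ifs with h
    · rw [h, Ring.choose_zero_pos ℤ (Nat.pos_of_ne_zero hi), Int.cast_zero, zero_mul, zero_smul]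
    · rw [smul_zero]

theorem tensorMode_vacuum_right (hz : z ≠ 0) (u : V) (n : ℤ) (f : W →ₗ[ℂ] U) :
    tensorMode z u (VertexOperatorAlgebra.vacuum : V) n f = leftAction z u f (-n - 1) := by
  rw [tensorMode, finsum_eq_single _ n]
  · rw [rightAction_vacuum hz, if_pos (by ring)]
  · intro i hi
    rw [rightAction_vacuum hz, if_neg (by lia), leftAction_zero hz]
    rfl

theorem tensorMode_vacuum_left (hz : z ≠ 0) (v : V) (n : ℤ) (f : W →ₗ[ℂ] U) :
    tensorMode z (VertexOperatorAlgebra.vacuum : V) v n f = rightAction z v f (-n - 1) := by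
  rw [tensorMode, finsum_eq_single _ (-1)]
  · rw [leftAction_vacuum hz, if_pos (by ring)]
    congr 1
    ring
  · intro i hi
    rw [leftAction_vacuum hz, if_neg (by lia)]

/-- The elements `v ⊗ 𝟏` and `𝟏 ⊗ v` bound the poles of `f Y^o(v, x)` at `z` and at `0`. -/
theorem poleBound_of_mem_Omega (hz : z ≠ 0) {f : W →ₗ[ℂ] U} (hf : f ∈ Omega V W U z) {n : ℤ}
    {v : V} (hv : v ∈ homog V n) : PoleBound z f v n n := by
  obtain ⟨hreg, hΩ⟩ := hf
  obtain ⟨k, l, h⟩ := mem_regular_iff.1 hreg v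
  have hL : PoleBound z f v n l := by
    refine (h.leftAction_eq_zero_iff hz n).1 fun p hp => ?_
    have h1 := hΩ n 0 v hv _ VertexOperatorAlgebra.vacuum_mem (-p - 1) (by lia)
    rwa [tensorMode_vacuum_right hz, show -(-p - 1) - 1 = p by ring] at h1
  refine (hL.rightAction_eq_zero_iff hz n).1 fun p hp => ?_
  have h1 := hΩ 0 n _ VertexOperatorAlgebra.vacuum_mem v hv (-p - 1) (by lia)
  rwa [tensorMode_vacuum_left hz, show -(-p - 1) - 1 = p by ring] at h1

theorem mulX_mulXAddPow_eq_zero_iff {f : W →ₗ[ℂ] U} {n : ℤ} {v : V} :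
    (∀ p < 0, mulX n (mulXAddPow (-z) n (compOpp f v)) p = 0) ↔ PoleBound z f v n n := by
  rw [poleBound_iff]
  simp only [mulX, LinearMap.ext_iff, LinearMap.zero_apply,
    mulXAddPow_apply _ _ (compOpp_upperTruncated f v)]
  constructor
  · intro h w p hp
    have := h (p + n) (by lia) w
    rwa [add_sub_cancel_right] at this
  · exact fun h p hp w => h w _ (by lia)

end Omega

end

end VOA

theorem proposition3p8 {V W U : Type*}
    [AddCommGroup V] [Module ℂ V] [VOA.VertexOperatorAlgebra V]
    [AddCommGroup W] [Module ℂ W] [VOA.WeakModule V W]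
    [AddCommGroup U] [Module ℂ U] (z : ℂ) (hz : z ≠ 0) :
    (VOA.homZhuA V W U z : Set (W →ₗ[ℂ] U)) = VOA.Omega V W U z ∧
    (VOA.homZhuA V W U z : Set (W →ₗ[ℂ] U)) =
      {f | ∀ n : ℤ, ∀ v ∈ VOA.homog V n, ∀ p < 0,
        VOA.mulX n (VOA.mulXAddPow (-z) n (VOA.compOpp f v)) p = 0} ∧
    ∀ f ∈ VOA.homZhuA V W U z, ∀ n : ℤ, ∀ v ∈ VOA.homog V n,
      VOA.mulAddXPow (-z) n (VOA.rightAction z v f) =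
        VOA.mulXAddPow (-z) n (VOA.compOpp f v) ∧
      VOA.mulAddXPow z n (VOA.leftAction z v f) =
        VOA.mulXAddPow z n (VOA.shift z (VOA.compOpp f v)) := by
  have hpole : ∀ f ∈ VOA.homZhuA V W U z, ∀ n : ℤ, ∀ v ∈ VOA.homog V n,
      VOA.PoleBound z f v n n := fun f hf n v hv =>
    (((VOA.mem_homZhuA_iff z f).1 hf).poleBound hv).mono le_rfl (by lia)
  refine ⟨Set.ext fun f => ⟨fun hf => ((VOA.mem_homZhuA_iff z f).1 hf).mem_Omega hz, fun hf => ?_⟩,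
    Set.ext fun f => ⟨fun hf n v hv => ?_, fun hf => ?_⟩, fun f hf n v hv => ?_⟩
  · exact (VOA.mem_homZhuA_iff z f).2
      (VOA.killsBelow_of_poleBound fun n v hv => VOA.poleBound_of_mem_Omega hz hf hv)
  · exact VOA.mulX_mulXAddPow_eq_zero_iff.2 (hpole f hf n v hv)
  · exact (VOA.mem_homZhuA_iff z f).2
      (VOA.killsBelow_of_poleBound fun n v hv => VOA.mulX_mulXAddPow_eq_zero_iff.1 (hf n v hv))
  · have h := hpole f hf n v hv
    exact ⟨h.mulAddXPow_rightAction hz, h.mulAddXPow_leftAction hz⟩
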